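/- Let $p\ge1$ and $1\le m_0\le m$ be integers and let $f\colon\mathbb R^p\to\mathbb R$ be $2m$ times continuously differentiable. Vectors are in boldface, $\mathbb Z_+=\{0,1,2,\dots\}$, $[p]=\{1,\dots,p\}$, inequalities between vectors and products of vectors are coordinatewise, $\mathbf 1=(1,\dots,1)$, $\mathbf 0=(0,\dots,0)$, $\mathbf 1_J$ is the indicator vector of $J\subseteq[p]$, $\|\boldsymbol\alpha\|=\alpha_1+\dots+\alpha_p$, $\mathbf x^{\boldsymbol\alpha}=\prod_r x_r^{\alpha_r}$, $\boldsymbol\alpha!=\prod_r\alpha_r!$, $\wedge\mathbf n=\min_r n_r$, $\vee\mathbf x=\max_r x_r$, and $h_{\mathbf c}(\mathbf x)=h(\mathbf x+\mathbf c)$. Sums over $\mathbf k,\mathbf i,\mathbf j$ are over vectors in $\mathbb Z_+^p$ within the indicated bounds, and an empty sum is $0$. A series $\sum_{\mathbf k\ge\mathbf 0}g(\mathbf k)$ is the limit of $\sum_{\mathbf k=\mathbf 0}^{\mathbf n-\mathbf 1}g(\mathbf k)$ as $\wedge\mathbf n\to\infty$. Let $F\colon\mathbb R^p\to\mathbb R$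 be any antiderivative of $f$, that is, $F^{(\mathbf 1)}=f$. Suppose that, for each $\boldsymbol\alpha\in\mathbb Z_+^p$ with $\|\boldsymbol\alpha\|=2m_0$, the derivative $F^{(\boldsymbol\alpha)}$ exists and $F^{(\boldsymbol\alpha)}(\mathbf x)\to0$ as $\vee\mathbf x\to\infty$. Say that a $C^{2m}$ function $g$ satisfies condition (U) if, for each $\boldsymbol\alpha\in\mathbb Z_+^p$ with $\|\boldsymbol\alpha\|=2m$, the sums $\sum_{\mathbf k=\mathbf 0}^{\mathbf n-\mathbf 1}g^{(\boldsymbol\alpha)}(\mathbf k+\mathbf u)$ converge uniformly in $\mathbf u\in[-m/2,m/2]^p$ as $\wedge\mathbf n\to\infty$. Suppose that $f$ satisfies (U). Put $$\gamma_{m,\mathbf j}=\prod_{r=1}^p\gamma_{m,j_r},\qquad \gamma_{m,j}=(-1)^{j-1}\,\frac2j\,\binom{2m}{m+j}\Big/\binom{2m}{m},$$ $$A^J_{m,F}(\mathbf n)=\sum_{\mathbf j=\mathbf 1}^{m\mathbf 1}\gamma_{m,\mathbf j}\sum_{\mathbf i=\mathbf 0}^{\mathbf j-\mathbf 1}F(\mathbf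 n\mathbf 1_J-\mathbf 1+\mathbf j/2-\mathbf i),\qquad \tilde A_{m,F}(\mathbf n)=\sum_{\emptyset\ne J\subseteq[p]}(-1)^{p-|J|}A^J_{m,F}(\mathbf n),$$ and, for $g$ satisfying (U), $$R_{m,g}(\infty)=\frac m{2^{2m+p-1}}\sum_{\|\boldsymbol\alpha\|=2m}\frac1{\boldsymbol\alpha!}\int_0^1ds\,(1-s)^{2m-1}\int_{[-1,1]^p}d\mathbf v\,\mathbf v^{\boldsymbol\alpha}\sum_{\mathbf j=\mathbf 1}^{m\mathbf 1}\gamma_{m,\mathbf j}\,\mathbf j^{\boldsymbol\alpha+\mathbf 1}\sum_{\mathbf k\ge\mathbf 0}g^{(\boldsymbol\alpha)}(\mathbf k+s\,\mathbf j\mathbf v/2).$$ Call $\mathbf c\in\mathbb Z_+^p$ admissible if $f_{\mathbf c\mathbf 1_J}$ satisfies (U) for every nonempty $J\subseteq[p]$, and for such $\mathbf c$ let $$R_{m,f,\mathbf c}(\infty)=-\sum_{\emptyset\ne J\subseteq[p]}(-1)^{|J|}\,R_{m,f_{\mathbf c\mathbf 1_J}}(\infty).$$ Then: 1. For every admissible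 $\mathbf c$, the limit below exists and $$\sum_{\mathbf k\ge\mathbf 0}^{\mathrm{Alt}}f(\mathbf k):=\lim_{\wedge\mathbf n\to\infty}\Big(\sum_{\mathbf k=\mathbf 0}^{\mathbf n-\mathbf 1}f(\mathbf k)-\tilde A_{m_0,F}(\mathbf n)\Big)=\sum_{\mathbf k=\mathbf 0}^{\mathbf c-\mathbf 1}f(\mathbf k)-\tilde A_{m,F}(\mathbf c)-R_{m,f,\mathbf c}(\infty).$$ 2. For every $\varepsilon>0$ there is $N$ such that $|R_{m,f,\mathbf c}(\infty)|<\varepsilon$ for every admissible $\mathbf c$ with $\wedge\mathbf c\ge N$. -/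

import Mathlib

open Filter Topology MeasureTheory

noncomputable section

namespace AltSum

variable {p : ℕ}

/-- `HasIterPartial [r₁, …, r_N] g h`: the iterated partial derivative
`∂_{r_N} ⋯ ∂_{r₁} g` exists everywhere on `ℝ^p` (every intermediate derivative included)
and equals `h`. -/
def HasIterPartial : List (Fin p) → ((Fin p → ℝ) → ℝ) → ((Fin p → ℝ) → ℝ) → Prop
  | [], g, h => g = h
  | r :: l, g, h => ∃ g' : (Fin p → ℝ) → ℝ,
      (∀ x, HasDerivAt (fun t : ℝ => g (Function.update x r t)) (g' x) (x r)) ∧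
        HasIterPartial l g' h

/-- The partial derivative `g^{(α)}` exists, for at least one order of the differentiations,
and equals `h`. No continuity of the derivatives is required. -/
def HasMixedPartial (α : Fin p → ℕ) (g h : (Fin p → ℝ) → ℝ) : Prop :=
  ∃ l : List (Fin p), (∀ r, l.count r = α r) ∧ HasIterPartial l g h

/-- `F` is an antiderivative of `f`: `F^{(1,…,1)} = f`. -/
def IsAntiderivative (F f : (Fin p → ℝ) → ℝ) : Prop :=
  HasMixedPartial (fun _ => 1) F f

/-- The partial derivative `∂g/∂x_r`, as a function. -/
def pderiv (r : Fin p) (g : (Fin p → ℝ) → ℝ) : (Fin p → ℝ) → ℝ :=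
  fun x => deriv (fun t : ℝ => g (Function.update x r t)) (x r)

/-- The function `g^{(α)}`; it is used only for functions that are continuously differentiable
`|α|` times, for which the order of the differentiations is immaterial. -/
def mixedPartial (α : Fin p → ℕ) (g : (Fin p → ℝ) → ℝ) : (Fin p → ℝ) → ℝ :=
  ((List.finRange p).flatMap fun r => List.replicate (α r) r).foldl (fun h r => pderiv r h) g

/-- The shift `h_c(x) = h(x + c)`. -/
def shift (h : (Fin p → ℝ) → ℝ) (c : Fin p → ℝ) : (Fin p → ℝ) → ℝ :=
  fun x => h (x + c)

/-- The vector `n 1_J`: the coordinates of `n` outside `J` are replaced by `0`. -/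
def restrict (n : Fin p → ℕ) (J : Finset (Fin p)) : Fin p → ℝ :=
  fun r => if r ∈ J then (n r : ℝ) else 0

/-- The rectangular partial sum `∑_{0 ≤ k ≤ n - 1} g(k)`. -/
def partialSum (g : (Fin p → ℝ) → ℝ) (n : Fin p → ℕ) : ℝ :=
  ∑ k ∈ Fintype.piFinset (fun r => Finset.range (n r)), g (fun r => (k r : ℝ))

/-- The sum of the series `∑_{k ≥ 0} g(k)`: the limit of the rectangular partial sums as
`min n_r → ∞` (this is the filter `atTop` of the product order on `ℕ^p`). -/
def seriesSum (g : (Fin p → ℝ) → ℝ) : ℝ :=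
  limUnder atTop (partialSum g)

/-- `γ_{m,j}` for one index `j ≥ 1`. -/
def gammaOne (m j : ℕ) : ℝ :=
  (-1) ^ (j - 1) * (2 / (j : ℝ)) * ((2 * m).choose (m + j) : ℝ) / ((2 * m).choose m : ℝ)

/-- `γ_{m,j} = ∏_r γ_{m,j_r}` for a multi-index `j`. -/
def gammaCoeff (m : ℕ) (j : Fin p → ℕ) : ℝ :=
  ∏ r, gammaOne m (j r)

/-- The multi-indices `j` with `1 ≤ j_r ≤ m` for all `r`. -/
def indexBox (p m : ℕ) : Finset (Fin p → ℕ) :=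
  Fintype.piFinset fun _ => Finset.Icc 1 m

/-- `A^J_{m,F}(n) = ∑_{1 ≤ j ≤ m} γ_{m,j} ∑_{0 ≤ i ≤ j - 1} F(n 1_J - 1 + j/2 - i)`. -/
def AJ (m : ℕ) (F : (Fin p → ℝ) → ℝ) (J : Finset (Fin p)) (n : Fin p → ℕ) : ℝ :=
  ∑ j ∈ indexBox p m, gammaCoeff m j *
    ∑ i ∈ Fintype.piFinset (fun r => Finset.range (j r)),
      F (fun r => restrict n J r - 1 + (j r : ℝ) / 2 - (i r : ℝ))

/-- `Ã_{m,F}(n) = ∑_{∅ ≠ J ⊆ [p]} (-1)^{p - |J|} A^J_{m,F}(n)`. -/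
def Atilde (m : ℕ) (F : (Fin p → ℝ) → ℝ) (n : Fin p → ℕ) : ℝ :=
  ∑ J : Finset (Fin p) with J.Nonempty, (-1) ^ (p - J.card) * AJ m F J n

/-- `s` is the generalized sum of `∑_{k ≥ 0} f(k)` (with respect to `m₀` and `F`):
`∑_{0 ≤ k ≤ n - 1} f(k) - Ã_{m₀,F}(n) → s` as `min n_r → ∞`. -/
def HasAltSum (m₀ : ℕ) (F f : (Fin p → ℝ) → ℝ) (s : ℝ) : Prop :=
  Tendsto (fun n : Fin p → ℕ => partialSum f n - Atilde m₀ F n) atTop (𝓝 s)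

/-- For each `α` with `|α| = 2m`, the series `∑_{k ≥ 0} f^{(α)}(k + u)` converges uniformly in
`u ∈ [-m/2, m/2]^p`, in the sense of its rectangular partial sums as `min n_r → ∞`. -/
def UnifConv (m : ℕ) (f : (Fin p → ℝ) → ℝ) : Prop :=
  ∀ α : Fin p → ℕ, ∑ r, α r = 2 * m →
    ∃ S : (Fin p → ℝ) → ℝ,
      TendstoUniformlyOn
        (fun (n : Fin p → ℕ) (u : Fin p → ℝ) => partialSum (shift (mixedPartial α f) u) n)
        S atTop (Set.Icc (fun _ => -((m : ℝ) / 2)) (fun _ => (m : ℝ) / 2))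

/-- The remainder `R_{m,f}(∞)`. The index `α` runs over the multi-indices with `|α| = 2m`. -/
def remainder (m : ℕ) (f : (Fin p → ℝ) → ℝ) : ℝ :=
  (m : ℝ) / 2 ^ (2 * m + p - 1) *
    ∑ α ∈ Finset.piAntidiag (Finset.univ : Finset (Fin p)) (2 * m),
      1 / (∏ r, ((α r).factorial : ℝ)) *
        ∫ s in (0 : ℝ)..1, (1 - s) ^ (2 * m - 1) *
          ∫ v in Set.Icc (fun _ : Fin p => (-1 : ℝ)) (fun _ => 1),
            (∏ r, v r ^ α r) *
              ∑ j ∈ indexBox p m, gammaCoeff m j * (∏ r, (j r : ℝ) ^ (α r + 1)) *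
                seriesSum (shift (mixedPartial α f) (fun r => s * (j r : ℝ) * v r / 2))

/-- The remainder `R_{m,f,c}(∞) = -∑_{∅ ≠ J ⊆ [p]} (-1)^{|J|} R_{m, f_{c 1_J}}(∞)`. -/
def shiftedRemainder (m : ℕ) (f : (Fin p → ℝ) → ℝ) (c : Fin p → ℕ) : ℝ :=
  -∑ J : Finset (Fin p) with J.Nonempty,
    (-1) ^ J.card * remainder m (shift f (restrict c J))

end AltSum

end

open AltSum

noncomputable section

namespace AltSum

variable {p : ℕ}

/-! In one variable, the integral of `f` over the interval of length `j` centred at `k` is `F (k +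
j/2) - F (k - j/2)`. The weights `γ_{m,j}` are the ones for which a combination of these integrals,
taken in every coordinate, returns `f k` exactly for polynomials of degree below `2m`
(`sum_gammaOne_mul_pow`, `sum_gammaCoeff_mul_integral`). For a general `f`, Taylor's formula leaves
an error in the derivatives of order `2m`. Summed over `k`, the central differences of `F` telescope
to corner terms (`avg_mul`), so the sum of `f` is the full alternating corner sum, `J = ∅` included,
minus a remainder (`partialRemainder_eq`); condition (U) and dominated convergence give the limit of
that remainder.

All of this is computed in the group algebra of `ℝ^p` acting by translations. Both the partial sums
and the corner sums come from products of one-dimensional cocycles `Q (c + d) = Q c + τ_c Q d`, so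
one inclusion–exclusion (`prod_sub_of_family`) moves the starting corner from `0` to the corners `c
1_J`. With `c` fixed and `n → ∞` this yields the formula, but with order `m` in `Ã(n)`.

Order `m` may be replaced by `m₀` because the moments of the averaging operators of degree below
`2m₀` do not depend on the order (`shiftMoment_eq`). The two operators therefore differ on `F` by a
Taylor remainder of order `2m₀`, which vanishes at infinity by hypothesis (`tendsto_Atilde_sub`).

The second claim follows from uniqueness of limits: every admissible `c`, in particular `c = 0`,
gives the same value, so the shifted remainder is the error of `partialSum f c - Atilde m F c`
against its own limit. -/

/-! ### Moments of the coefficients `γ` -/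

/-- A finite difference of order `2m` kills polynomials of degree below `2m`. Starting it at `-m`
makes the nodes symmetric about `0`. -/
lemma sum_range_alternating_choose_mul_pow (m q : ℕ) (hq : q < m) :
    ∑ k ∈ Finset.range (2 * m + 1),
      (-1 : ℝ) ^ k * ((2 * m).choose k : ℝ) * ((k : ℝ) - m) ^ (2 * q) = 0 := by
  have h1 : (∑ k ∈ Finset.range (2 * q + 1),
      (if k = 2 * q then (1 : ℝ) else 0) • fun x : ℝ => x ^ k) = fun x : ℝ => x ^ (2 * q) := by
    simp
  have h := fwdDiff_iter_eq_sum_shift (1 : ℝ) (fun x : ℝ => x ^ (2 * q)) (2 * m) (-(m : ℝ))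
  rw [fwdDiff_iter_pow_eq_zero_of_lt (by omega : 2 * q < 2 * m)] at h
  rw [Pi.zero_apply] at h
  rw [h]
  refine Finset.sum_congr rfl fun k hk => ?_
  have hk' : k ≤ 2 * m := by simpa [Nat.lt_succ_iff] using hk
  have h2 : (-1 : ℝ) ^ (2 * m - k) = (-1) ^ k := by
    have : (-1 : ℝ) ^ (2 * m - k) * (-1) ^ k = (-1) ^ k * (-1) ^ k := by
      rw [← pow_add, Nat.sub_add_cancel hk', ← pow_add, pow_mul, ← two_mul, pow_mul]; simp
    exact mul_right_cancel₀ (pow_ne_zero _ (by norm_num)) this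
  simp only [nsmul_eq_mul, mul_one, zsmul_eq_mul]
  push_cast
  rw [h2]
  ring

/-- The odd moments of the coefficients `γ_{m,j}`. -/
lemma sum_gammaOne_mul_pow (m q : ℕ) (hq : q < m) :
    ∑ j ∈ Finset.Icc 1 m, gammaOne m j * (j : ℝ) ^ (2 * q + 1) = if q = 0 then 1 else 0 := by
  have h := sum_range_alternating_choose_mul_pow m q hq
  -- Splits off the central index `k = m`. The two outer halves agree after reflection because even
  -- powers and binomial coefficients are symmetric.
  have hsplit : 2 * m + 1 = m + (1 + m) := by ring
  rw [hsplit, Finset.sum_range_add, Finset.sum_range_add, ← Finset.sum_range_reflect] at h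
  set T : ℕ → ℝ := fun i =>
    (-1 : ℝ) ^ (m + (1 + i)) * ((2 * m).choose (m + (1 + i)) : ℝ) * ((1 : ℝ) + i) ^ (2 * q) with hT
  have e1 : ∑ j ∈ Finset.range m, (-1 : ℝ) ^ (m - 1 - j) * ((2 * m).choose (m - 1 - j) : ℝ) *
      (((m - 1 - j : ℕ) : ℝ) - m) ^ (2 * q) = ∑ i ∈ Finset.range m, T i := by
    refine Finset.sum_congr rfl fun i hi => ?_
    have hi' : i < m := by simpa using hi
    obtain ⟨d, rfl⟩ : ∃ d, m = d + 1 + i := ⟨m - 1 - i, by omega⟩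
    have e : d + 1 + i - 1 - i = d := by omega
    rw [hT, e]
    have hc : (2 * (d + 1 + i)).choose (d + 1 + i + (1 + i)) = (2 * (d + 1 + i)).choose d :=
      Nat.choose_symm_of_eq_add (by omega)
    simp only [hc]
    have hs : (-1 : ℝ) ^ (d + 1 + i + (1 + i)) = (-1) ^ d := by
      have : d + 1 + i + (1 + i) = d + 2 * (1 + i) := by ring
      rw [this, pow_add, pow_mul]; simp
    rw [hs]
    congr 1
    push_cast
    rw [pow_mul, pow_mul]
    congr 1
    ring
  have e3 : ∑ i ∈ Finset.range m, (-1 : ℝ) ^ (m + (1 + i)) * ((2 * m).choose (m + (1 + i)) : ℝ) *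
      (((m + (1 + i) : ℕ) : ℝ) - m) ^ (2 * q) = ∑ i ∈ Finset.range m, T i := by
    refine Finset.sum_congr rfl fun i _ => ?_
    simp only [hT]
    congr 2
    push_cast
    ring
  rw [e1, e3] at h
  simp only [Finset.range_one, Finset.sum_singleton, add_zero, sub_self] at h
  have hc : ((2 * m).choose m : ℝ) ≠ 0 := by
    exact_mod_cast (Nat.choose_pos (by omega)).ne'
  have hneg : ((-1 : ℝ) ^ m) * (-1) ^ m = 1 := by rw [← mul_pow]; simp
  have hmain : ∑ j ∈ Finset.Icc 1 m, gammaOne m j * (j : ℝ) ^ (2 * q + 1) =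
      -((-1) ^ m / ((2 * m).choose m : ℝ)) * (2 * ∑ i ∈ Finset.range m, T i) := by
    rw [Finset.range_eq_Ico, Finset.mul_sum, Finset.mul_sum]
    rw [← Finset.Ico_succ_right_eq_Icc, Finset.sum_Ico_eq_sum_range, ← Finset.range_eq_Ico]
    refine Finset.sum_congr rfl fun i _ => ?_
    simp only [hT, gammaOne]
    have hj : ((1 : ℝ) + i) ≠ 0 := by positivity
    push_cast
    rw [Nat.add_sub_cancel_left, pow_add (-1 : ℝ) m, pow_add (-1 : ℝ) 1]
    field_simp
    have : ((-1 : ℝ) ^ m) ^ 2 = 1 := by rw [sq, hneg]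
    rw [this]
    ring
  rw [hmain]
  -- The central term carries `0 ^ (2 * q)`, which is `1` for `q = 0` and `0` otherwise; this is the
  -- only source of the nonzero moment.
  split_ifs with h0
  · subst h0
    simp only [mul_zero, pow_zero, mul_one] at h hc ⊢
    have : (2 * ∑ i ∈ Finset.range m, T i) = -((-1) ^ m * ((2 * m).choose m : ℝ)) := by linarith
    rw [this]
    field_simp
    rw [sq, hneg]
  · have hz : (0 : ℝ) ^ (2 * q) = 0 := zero_pow (by omega)
    rw [hz] at h
    have : (2 * ∑ i ∈ Finset.range m, T i) = 0 := by linarith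
    rw [this, mul_zero]

/-- The moments `∑_j γ_{m,j} ∑_{i<j} (j/2 - 1 - i)^q`. -/
def shiftMoment (m q : ℕ) : ℝ :=
  ∑ j ∈ Finset.Icc 1 m, gammaOne m j * ∑ i ∈ Finset.range j, (-1 + (j : ℝ) / 2 - (i : ℝ)) ^ q

/-- The binomial theorem turns the left side into differences `(x + 1)^(q+1) - x^(q+1)`, which
telescope in `i` to `(j/2)^(q+1) - (-j/2)^(q+1)`. This is zero for odd `q` and an odd moment for
even `q`. The result is the recursion of the Bernoulli numbers. -/
lemma sum_choose_mul_shiftMoment (m q : ℕ) (hq : q < 2 * m) :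
    ∑ i ∈ Finset.range (q + 1), ((q + 1).choose i : ℝ) * shiftMoment m i =
      if q = 0 then 1 else 0 := by
  have h1 : ∑ i ∈ Finset.range (q + 1), ((q + 1).choose i : ℝ) * shiftMoment m i =
      ∑ j ∈ Finset.Icc 1 m, gammaOne m j * (((j : ℝ) / 2) ^ (q + 1) - (-((j : ℝ) / 2)) ^ (q + 1)) := by
    simp only [shiftMoment, Finset.mul_sum]
    rw [Finset.sum_comm]
    refine Finset.sum_congr rfl fun j _ => ?_
    rw [Finset.sum_comm]
    have h2 : ∀ i ∈ Finset.range j, ∑ k ∈ Finset.range (q + 1),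
        ((q + 1).choose k : ℝ) * (gammaOne m j * (-1 + (j : ℝ) / 2 - (i : ℝ)) ^ k) =
        gammaOne m j * (((j : ℝ) / 2 - (i : ℝ)) ^ (q + 1) -
          ((j : ℝ) / 2 - ((i + 1 : ℕ) : ℝ)) ^ (q + 1)) := by
      intro i _
      have hb := add_pow (-1 + (j : ℝ) / 2 - (i : ℝ)) 1 (q + 1)
      rw [Finset.sum_range_succ] at hb
      simp only [one_pow, mul_one, Nat.choose_self, Nat.cast_one] at hb
      have ha : (-1 + (j : ℝ) / 2 - (i : ℝ)) + 1 = (j : ℝ) / 2 - i := by ring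
      have hc : (j : ℝ) / 2 - ((i + 1 : ℕ) : ℝ) = -1 + (j : ℝ) / 2 - (i : ℝ) := by
        push_cast; ring
      rw [ha] at hb
      rw [hc, hb, add_sub_cancel_right, Finset.mul_sum]
      exact Finset.sum_congr rfl fun k _ => by ring
    rw [Finset.sum_congr rfl h2, ← Finset.mul_sum,
      Finset.sum_range_sub' (fun i : ℕ => ((j : ℝ) / 2 - (i : ℝ)) ^ (q + 1))]
    congr 3
    · simp
    · ring
  rw [h1]
  rcases Nat.even_or_odd' q with ⟨k, rfl | rfl⟩
  · have h := sum_gammaOne_mul_pow m k (by omega)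
    have : ∀ j ∈ Finset.Icc 1 m, gammaOne m j *
        (((j : ℝ) / 2) ^ (2 * k + 1) - (-((j : ℝ) / 2)) ^ (2 * k + 1)) =
        (1 / 2) ^ (2 * k) * (gammaOne m j * (j : ℝ) ^ (2 * k + 1)) := by
      intro j _
      rw [Odd.neg_pow ⟨k, rfl⟩, div_pow, div_pow, pow_succ (2 : ℝ)]
      field_simp
      ring
    rw [Finset.sum_congr rfl this, ← Finset.mul_sum, h]
    rcases k with _ | k <;> simp
  · have : ∀ x : ℝ, (-x) ^ (2 * k + 1 + 1) = x ^ (2 * k + 1 + 1) := fun x =>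
      Even.neg_pow ⟨k + 1, by ring⟩ x
    simp [this]

/-- The recursion does not mention the order and determines the moments successively, the leading
coefficient `q + 1` being nonzero. -/
lemma shiftMoment_eq (m m' : ℕ) (h : m ≤ m') (q : ℕ) (hq : q < 2 * m) :
    shiftMoment m' q = shiftMoment m q := by
  induction q using Nat.strong_induction_on with
  | _ q ih =>
    have h1 := sum_choose_mul_shiftMoment m q hq
    have h2 := sum_choose_mul_shiftMoment m' q (by omega)
    rw [Finset.sum_range_succ] at h1 h2
    have h3 : ∑ i ∈ Finset.range q, ((q + 1).choose i : ℝ) * shiftMoment m' i =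
        ∑ i ∈ Finset.range q, ((q + 1).choose i : ℝ) * shiftMoment m i :=
      Finset.sum_congr rfl fun i hi => by
        have : i < q := by simpa using hi
        rw [ih i this (by omega)]
    have h4 : ((q + 1).choose q : ℝ) ≠ 0 := by
      exact_mod_cast (Nat.choose_pos (by omega)).ne'
    refine mul_left_cancel₀ h4 ?_
    linarith

/-! ### Translation operators in the group algebra of `ℝ^p` -/

/-- The action of the group algebra of `ℝ^p` on functions by translations. -/
def act : AddMonoidAlgebra ℝ (Fin p → ℝ) →ₐ[ℝ] Module.End ℝ ((Fin p → ℝ) → ℝ) :=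
  AddMonoidAlgebra.lift ℝ _ _
    { toFun := fun y =>
        { toFun := fun G x => G (x + y.toAdd)
          map_add' := fun _ _ => rfl
          map_smul' := fun _ _ => rfl }
      map_one' := by ext G x; simp
      map_mul' := fun y z => by
        ext G x
        simp only [toAdd_mul, LinearMap.coe_mk, AddHom.coe_mk, Module.End.mul_apply]
        congr 1
        abel }

/-- The translation by `y`, as an element of the group algebra. -/
def trans (y : Fin p → ℝ) : AddMonoidAlgebra ℝ (Fin p → ℝ) := AddMonoidAlgebra.single y 1

/-- The translation by `t` in the coordinate `r`. -/
def trans₁ (r : Fin p) (t : ℝ) : AddMonoidAlgebra ℝ (Fin p → ℝ) := trans (Pi.single r t)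

lemma act_trans (y : Fin p → ℝ) (G : (Fin p → ℝ) → ℝ) (x : Fin p → ℝ) :
    act (trans y) G x = G (x + y) := by
  simp [act, trans]

lemma act_trans_eq_shift (y : Fin p → ℝ) (G : (Fin p → ℝ) → ℝ) :
    act (trans y) G = shift G y := by
  ext x; rw [act_trans, shift]

lemma act_mul (a b : AddMonoidAlgebra ℝ (Fin p → ℝ)) (G : (Fin p → ℝ) → ℝ) :
    act (a * b) G = act a (act b G) := by
  rw [map_mul, Module.End.mul_apply]

lemma act_add (a b : AddMonoidAlgebra ℝ (Fin p → ℝ)) (G : (Fin p → ℝ) → ℝ) (x : Fin p → ℝ) :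
    act (a + b) G x = act a G x + act b G x := by
  rw [map_add]; rfl

lemma act_sub (a b : AddMonoidAlgebra ℝ (Fin p → ℝ)) (G : (Fin p → ℝ) → ℝ) (x : Fin p → ℝ) :
    act (a - b) G x = act a G x - act b G x := by
  rw [map_sub]; rfl

lemma act_smul (w : ℝ) (a : AddMonoidAlgebra ℝ (Fin p → ℝ)) (G : (Fin p → ℝ) → ℝ)
    (x : Fin p → ℝ) : act (w • a) G x = w * act a G x := by
  rw [map_smul]; rfl

lemma act_sum {ι : Type*} (s : Finset ι) (a : ι → AddMonoidAlgebra ℝ (Fin p → ℝ))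
    (G : (Fin p → ℝ) → ℝ) (x : Fin p → ℝ) :
    act (∑ i ∈ s, a i) G x = ∑ i ∈ s, act (a i) G x := by
  rw [map_sum, LinearMap.sum_apply, Finset.sum_apply]

lemma trans_zero : trans (0 : Fin p → ℝ) = 1 := rfl

lemma trans_mul (y z : Fin p → ℝ) : trans y * trans z = trans (y + z) := by
  simp [trans, AddMonoidAlgebra.single_mul_single]

lemma trans₁_zero (r : Fin p) : trans₁ r 0 = 1 := by
  rw [trans₁, Pi.single_zero, trans_zero]

lemma trans₁_mul (r : Fin p) (s t : ℝ) : trans₁ r s * trans₁ r t = trans₁ r (s + t) := by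
  rw [trans₁, trans₁, trans₁, trans_mul, Pi.single_add]

lemma prod_trans {ι : Type*} (s : Finset ι) (y : ι → Fin p → ℝ) :
    ∏ i ∈ s, trans (y i) = trans (∑ i ∈ s, y i) := by
  classical
  induction s using Finset.induction_on with
  | empty => simp [trans_zero]
  | insert a s ha ih => rw [Finset.prod_insert ha, Finset.sum_insert ha, ih, trans_mul]

lemma prod_trans₁ (y : Fin p → ℝ) : ∏ r, trans₁ r (y r) = trans y := by
  simp only [trans₁]
  rw [prod_trans, Finset.univ_sum_single]

/-- The one-dimensional operator `∑_j γ_{m,j} ∑_{i<j} τ_{j/2-1-i}` in the coordinate `r`. -/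
def avg₁ (m : ℕ) (r : Fin p) : AddMonoidAlgebra ℝ (Fin p → ℝ) :=
  ∑ j ∈ Finset.Icc 1 m, gammaOne m j •
    ∑ i ∈ Finset.range j, trans₁ r (-1 + (j : ℝ) / 2 - (i : ℝ))

/-- The product of the operators `avg₁ m r`. -/
def avg (m : ℕ) : AddMonoidAlgebra ℝ (Fin p → ℝ) := ∏ r, avg₁ m r

lemma avg_eq (m : ℕ) : avg (p := p) m = ∑ j ∈ indexBox p m, gammaCoeff m j •
    ∑ i ∈ Fintype.piFinset (fun r => Finset.range (j r)),
      trans (fun r => -1 + (j r : ℝ) / 2 - (i r : ℝ)) := by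
  simp only [avg, avg₁, indexBox]
  rw [Finset.prod_univ_sum]
  refine Finset.sum_congr rfl fun j _ => ?_
  rw [gammaCoeff, Finset.prod_smul, Finset.prod_univ_sum]
  congr 1
  refine Finset.sum_congr rfl fun i _ => ?_
  exact prod_trans₁ fun r => -1 + (j r : ℝ) / 2 - (i r : ℝ)

lemma AJ_eq_act (m : ℕ) (F : (Fin p → ℝ) → ℝ) (J : Finset (Fin p)) (n : Fin p → ℕ) :
    AJ m F J n = act (avg m) F (restrict n J) := by
  rw [avg_eq, act_sum, AJ]
  refine Finset.sum_congr rfl fun j _ => ?_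
  rw [act_smul, act_sum]
  congr 1
  refine Finset.sum_congr rfl fun i _ => ?_
  rw [act_trans]
  congr 1
  ext r
  simp only [Pi.add_apply]
  ring

/-- `∑_{k<n} τ_k` in the coordinate `r`. -/
def geom₁ (r : Fin p) (n : ℕ) : AddMonoidAlgebra ℝ (Fin p → ℝ) :=
  ∑ k ∈ Finset.range n, trans₁ r (k : ℝ)

lemma prod_geom₁ (n : Fin p → ℕ) : ∏ r, geom₁ r (n r) =
    ∑ k ∈ Fintype.piFinset (fun r => Finset.range (n r)), trans (fun r => (k r : ℝ)) := by
  simp only [geom₁]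
  rw [Finset.prod_univ_sum]
  exact Finset.sum_congr rfl fun k _ => prod_trans₁ fun r => (k r : ℝ)

lemma partialSum_eq_act (g : (Fin p → ℝ) → ℝ) (n : Fin p → ℕ) :
    partialSum g n = act (∏ r, geom₁ r (n r)) g 0 := by
  rw [prod_geom₁, act_sum, partialSum]
  exact Finset.sum_congr rfl fun k _ => by rw [act_trans, zero_add]

lemma geom₁_add (r : Fin p) (c d : ℕ) :
    geom₁ r (c + d) = geom₁ r c + trans₁ r (c : ℝ) * geom₁ r d := by
  rw [geom₁, Finset.sum_range_add, geom₁, geom₁, Finset.mul_sum]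
  congr 1
  exact Finset.sum_congr rfl fun k _ => by rw [trans₁_mul]; push_cast; rfl

/-- The central difference `τ_t - τ_{-t}` in the coordinate `r`. -/
def centralDiff (r : Fin p) (t : ℝ) : AddMonoidAlgebra ℝ (Fin p → ℝ) :=
  trans₁ r t - trans₁ r (-t)

/-- Two telescopings: `τ_n - 1` is `geom₁` times `τ_1 - 1`, and `avg₁` times `τ_1 - 1` collapses to
weighted central differences. Boundary values of `F` thus become a sum over lattice points. -/
lemma avg₁_mul (m : ℕ) (r : Fin p) (n : ℕ) :
    avg₁ m r * (trans₁ r (n : ℝ) - 1) =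
      geom₁ r n * ∑ j ∈ Finset.Icc 1 m, gammaOne m j • centralDiff r ((j : ℝ) / 2) := by
  have h1 : trans₁ r (n : ℝ) - 1 = geom₁ r n * (trans₁ r 1 - 1) := by
    rw [geom₁, Finset.sum_mul]
    have := Finset.sum_range_sub (fun k : ℕ => trans₁ r (k : ℝ)) n
    simp only [Nat.cast_zero, trans₁_zero] at this
    rw [← this]
    refine Finset.sum_congr rfl fun k _ => ?_
    rw [mul_sub, trans₁_mul, mul_one]
    push_cast
    rfl
  have h2 : avg₁ m r * (trans₁ r 1 - 1) =
      ∑ j ∈ Finset.Icc 1 m, gammaOne m j • centralDiff r ((j : ℝ) / 2) := by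
    rw [avg₁, Finset.sum_mul]
    refine Finset.sum_congr rfl fun j _ => ?_
    rw [smul_mul_assoc, Finset.sum_mul]
    congr 1
    have h3 : ∀ i ∈ Finset.range j, trans₁ r (-1 + (j : ℝ) / 2 - (i : ℝ)) * (trans₁ r 1 - 1) =
        trans₁ r ((j : ℝ) / 2 - (i : ℝ)) - trans₁ r ((j : ℝ) / 2 - ((i + 1 : ℕ) : ℝ)) := by
      intro i _
      rw [mul_sub, trans₁_mul, mul_one]
      congr 2 <;> (push_cast; ring)
    rw [Finset.sum_congr rfl h3,
      Finset.sum_range_sub' (fun i : ℕ => trans₁ r ((j : ℝ) / 2 - (i : ℝ))), centralDiff]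
    congr 2
    · simp
    · ring
  rw [h1, mul_left_comm, h2]

lemma avg_mul (m : ℕ) (n : Fin p → ℕ) :
    avg m * ∏ r, (trans₁ r (n r : ℝ) - 1) =
      (∏ r, geom₁ r (n r)) * ∑ j ∈ indexBox p m, gammaCoeff m j •
        ∏ r, centralDiff r ((j r : ℝ) / 2) := by
  rw [avg, ← Finset.prod_mul_distrib, Finset.prod_congr rfl fun r _ => avg₁_mul m r (n r),
    Finset.prod_mul_distrib, Finset.prod_univ_sum]
  congr 1
  refine Finset.sum_congr rfl fun j _ => ?_
  rw [gammaCoeff, Finset.prod_smul]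

/-! ### Inclusion–exclusion over sets of coordinates -/

lemma prod_piece (c : Fin p → ℕ) (J : Finset (Fin p)) :
    ∏ r ∈ J, trans₁ r (c r : ℝ) = trans (restrict c J) := by
  rw [← prod_trans₁, ← Finset.prod_subset (Finset.subset_univ J)]
  · exact Finset.prod_congr rfl fun r hr => by simp [restrict, hr]
  · intro r _ hr
    simp [restrict, hr, trans₁_zero]

lemma prod_trans₁_sub_one (n : Fin p → ℕ) :
    ∏ r, (trans₁ r (n r : ℝ) - 1) =
      ∑ J : Finset (Fin p), (-1 : ℝ) ^ (p - J.card) • trans (restrict n J) := by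
  simp only [sub_eq_add_neg]
  rw [Finset.prod_add, Finset.powerset_univ]
  refine Finset.sum_congr rfl fun J _ => ?_
  rw [prod_piece, Finset.prod_const, ← Finset.compl_eq_univ_sdiff, Finset.card_compl,
    Fintype.card_fin, mul_comm, Algebra.smul_def]
  simp only [map_pow, map_neg, map_one]

/-- Subtracting `(-1)^p` removes the term `J = ∅` from the expanded product. -/
lemma Atilde_eq_act (m : ℕ) (F : (Fin p → ℝ) → ℝ) (n : Fin p → ℕ) :
    Atilde m F n = act (avg m * (∏ r, (trans₁ r (n r : ℝ) - 1) - (-1) ^ p)) F 0 := by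
  rw [prod_trans₁_sub_one, ← Finset.sum_filter_add_sum_filter_not _ (fun J => J.Nonempty)]
  have h : (∑ J : Finset (Fin p) with ¬ J.Nonempty,
      (-1 : ℝ) ^ (p - J.card) • trans (restrict n J)) = (-1) ^ p := by
    have : (Finset.univ.filter fun J : Finset (Fin p) => ¬ J.Nonempty) = {∅} := by
      ext J; simp
    have h0 : restrict n ∅ = 0 := by ext r; simp [restrict]
    rw [this, Finset.sum_singleton, h0, trans_zero, Algebra.smul_def]
    simp only [map_pow, map_neg, map_one, Finset.card_empty, Nat.sub_zero, mul_one]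
  rw [h, add_sub_cancel_right, Atilde, Finset.mul_sum, act_sum]
  refine Finset.sum_congr rfl fun J _ => ?_
  rw [mul_smul_comm, act_smul, mul_comm (avg m), act_mul, act_trans, zero_add, AJ_eq_act]

/-- The truncated difference `n - c 1_J`. -/
def subOn (n c : Fin p → ℕ) (J : Finset (Fin p)) : Fin p → ℕ :=
  fun r => n r - if r ∈ J then c r else 0

/-- The difference between the approximation of the partial sum and the partial sum. -/
def partialRemainder (m : ℕ) (G g : (Fin p → ℝ) → ℝ) (n : Fin p → ℕ) : ℝ :=
  act (avg m * ∏ r, (trans₁ r (n r : ℝ) - 1)) G 0 - partialSum g n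

/-- The cocycle relation gives `Q c = Q n - τ_c Q (n - c)` in each coordinate. Expanding the
product, `J` records the coordinates where the second term is chosen; `J = ∅` gives the product at
`n`. -/
lemma prod_sub_of_family (Q : Fin p → ℕ → AddMonoidAlgebra ℝ (Fin p → ℝ))
    (hQ : ∀ r c d, Q r (c + d) = Q r c + trans₁ r (c : ℝ) * Q r d)
    (n c : Fin p → ℕ) (hc : c ≤ n) :
    ∏ r, Q r (c r) = ∏ r, Q r (n r) + ∑ J : Finset (Fin p) with J.Nonempty,
      (-1 : ℝ) ^ J.card • (trans (restrict c J) * ∏ r, Q r (subOn n c J r)) := by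
  have h1 : ∀ r, Q r (c r) = -(trans₁ r (c r : ℝ) * Q r (n r - c r)) + Q r (n r) := by
    intro r
    have := hQ r (c r) (n r - c r)
    rw [Nat.add_sub_cancel' (hc r)] at this
    rw [this]
    ring
  have h2 : ∏ r, Q r (c r) = ∑ J : Finset (Fin p),
      (-1 : ℝ) ^ J.card • (trans (restrict c J) * ∏ r, Q r (subOn n c J r)) := by
    rw [Finset.prod_congr rfl fun r _ => h1 r, Finset.prod_add, Finset.powerset_univ]
    refine Finset.sum_congr rfl fun J _ => ?_
    rw [Finset.prod_neg, Finset.prod_mul_distrib, prod_piece, Algebra.smul_def,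
      ← Finset.prod_sdiff (Finset.subset_univ J) (f := fun r => Q r (subOn n c J r))]
    have e1 : ∏ r ∈ J, Q r (subOn n c J r) = ∏ r ∈ J, Q r (n r - c r) :=
      Finset.prod_congr rfl fun r hr => by simp [subOn, hr]
    have e2 : ∏ r ∈ Finset.univ \ J, Q r (subOn n c J r) = ∏ r ∈ Finset.univ \ J, Q r (n r) :=
      Finset.prod_congr rfl fun r hr => by
        have : r ∉ J := (Finset.mem_sdiff.1 hr).2
        simp [subOn, this]
    rw [e1, e2]
    simp only [map_pow, map_neg, map_one]
    ring
  rw [h2, ← Finset.sum_filter_add_sum_filter_not _ (fun J => J.Nonempty), add_comm]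
  congr 1
  have : (Finset.univ.filter fun J : Finset (Fin p) => ¬ J.Nonempty) = {∅} := by
    ext J; simp
  have h0 : restrict c ∅ = 0 := by ext r; simp [restrict]
  rw [this, Finset.sum_singleton, h0, trans_zero]
  simp [subOn]

/-- The same inclusion–exclusion is applied to the summation operator on `f` and to the corner
operator on `F`. The constant `(-1)^p` in `Atilde_eq_act` is common to `n` and `c`, so only
remainders for the shifted functions are left. -/
lemma partialSum_sub_Atilde (m : ℕ) (F f : (Fin p → ℝ) → ℝ) (n c : Fin p → ℕ) (hc : c ≤ n) :
    partialSum f n - Atilde m F n = partialSum f c - Atilde m F c +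
      ∑ J : Finset (Fin p) with J.Nonempty, (-1) ^ J.card *
        partialRemainder m (shift F (restrict c J)) (shift f (restrict c J)) (subOn n c J) := by
  have hS := prod_sub_of_family (p := p) geom₁ geom₁_add n c hc
  have hV := prod_sub_of_family (p := p) (fun r k => trans₁ r (k : ℝ) - 1) (fun r c d => by
    push_cast
    rw [← trans₁_mul]
    ring) n c hc
  have e1 := congrArg (fun a => act a f 0) hS
  have e2 := congrArg (fun a => act (avg m * (a - (-1) ^ p)) F 0) hV
  rw [← partialSum_eq_act, act_add, ← partialSum_eq_act, act_sum] at e1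
  rw [← Atilde_eq_act, add_sub_right_comm, mul_add, act_add, ← Atilde_eq_act, Finset.mul_sum,
    act_sum] at e2
  rw [e1, e2]
  have e3 : ∀ J : Finset (Fin p), (-1) ^ J.card *
        partialRemainder m (shift F (restrict c J)) (shift f (restrict c J)) (subOn n c J) =
      act (avg m * (-1 : ℝ) ^ J.card • (trans (restrict c J) *
        ∏ r, (trans₁ r (subOn n c J r : ℝ) - 1))) F 0 -
      act ((-1 : ℝ) ^ J.card • (trans (restrict c J) * ∏ r, geom₁ r (subOn n c J r))) f 0 := by
    intro J
    rw [partialRemainder, partialSum_eq_act, ← act_trans_eq_shift, ← act_trans_eq_shift,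
      ← act_mul, ← act_mul, mul_smul_comm, act_smul, act_smul, mul_sub, mul_assoc,
      mul_comm _ (trans (restrict c J)), mul_comm _ (trans (restrict c J))]
  simp only [e3, Finset.sum_sub_distrib]
  ring

/-- Localizes the remainder: it becomes a sum of pointwise quadrature errors, to which Taylor's
formula applies. -/
lemma partialRemainder_eq_sum (m : ℕ) (G g : (Fin p → ℝ) → ℝ) (n : Fin p → ℕ) :
    partialRemainder m G g n = partialSum (fun x => ∑ j ∈ indexBox p m, gammaCoeff m j *
      act (∏ r, centralDiff r ((j r : ℝ) / 2)) G x - g x) n := by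
  rw [partialRemainder, avg_mul, act_mul, ← partialSum_eq_act, partialSum, partialSum, partialSum,
    ← Finset.sum_sub_distrib]
  refine Finset.sum_congr rfl fun k _ => ?_
  rw [act_sum]
  simp only [act_smul]

/-! ### Taylor's formula along one coordinate -/

lemma hasIterPartial_replicate {r : Fin p} {N : ℕ} {F G : (Fin p → ℝ) → ℝ}
    (h : HasIterPartial (List.replicate N r) F G) :
    ∃ φ : ℕ → (Fin p → ℝ) → ℝ, φ 0 = F ∧ φ N = G ∧ ∀ q < N, ∀ x,
      HasDerivAt (fun t : ℝ => φ q (Function.update x r t)) (φ (q + 1) x) (x r) := by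
  induction N generalizing F with
  | zero => exact ⟨fun _ => F, rfl, h, fun q hq => absurd hq (Nat.not_lt_zero q)⟩
  | succ N ih =>
    obtain ⟨F', hd, h'⟩ := h
    obtain ⟨φ, h0, hN, hφ⟩ := ih h'
    refine ⟨fun q => Nat.casesOn q F φ, rfl, hN, fun q hq x => ?_⟩
    rcases q with _ | q
    · simpa [h0] using hd x
    · exact hφ q (by omega) x

lemma hasIterPartial_of_pure {r : Fin p} {N : ℕ} {F G : (Fin p → ℝ) → ℝ}
    (h : HasMixedPartial (Pi.single r N) F G) : HasIterPartial (List.replicate N r) F G := by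
  obtain ⟨l, hl, hG⟩ := h
  have hmem : ∀ b ∈ l, b = r := by
    intro b hb
    by_contra hne
    have := hl b
    rw [Pi.single_eq_of_ne hne] at this
    exact (List.count_pos_iff.2 hb).ne' this
  have hlen : l.length = N := by
    have h1 := hl r
    rw [Pi.single_eq_same, List.count_eq_length.2 fun b hb => (hmem b hb).symm] at h1
    exact h1
  rwa [List.eq_replicate_iff.2 ⟨hlen, hmem⟩] at hG

/-- Taylor's formula with a bound for the remainder. -/
lemma abs_sub_taylor_le (N : ℕ) (φ : ℕ → ℝ → ℝ)
    (hφ : ∀ q < N, ∀ t, HasDerivAt (φ q) (φ (q + 1) t) t) (x K ε : ℝ)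
    (hε : ∀ t, |t| ≤ K → |φ N (x + t)| ≤ ε) (u : ℝ) (hu : |u| ≤ K) :
    |φ 0 (x + u) - ∑ q ∈ Finset.range N, φ q x * (u ^ q / (q.factorial : ℝ))| ≤ ε * K ^ N := by
  induction N generalizing φ u with
  | zero => simpa using hε u hu
  | succ N ih =>
    set ψ : ℝ → ℝ := fun u => φ 0 (x + u) -
      ∑ q ∈ Finset.range (N + 1), φ q x * (u ^ q / (q.factorial : ℝ)) with hψ
    have hder : ∀ t, HasDerivAt ψ (φ 1 (x + t) -
        ∑ q ∈ Finset.range N, φ (q + 1) x * (t ^ q / (q.factorial : ℝ))) t := by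
      intro t
      refine HasDerivAt.sub ?_ ?_
      · exact (hφ 0 (by omega) (x + t)).comp_const_add x t
      · have h1 : (fun u : ℝ => ∑ q ∈ Finset.range (N + 1),
            φ q x * (u ^ q / (q.factorial : ℝ))) = fun u : ℝ => (∑ q ∈ Finset.range N,
            φ (q + 1) x * (u ^ (q + 1) / ((q + 1).factorial : ℝ))) + φ 0 x := by
          ext u
          rw [Finset.sum_range_succ']
          simp
        rw [h1]
        refine HasDerivAt.add_const _ (HasDerivAt.fun_sum fun q _ => ?_)
        refine HasDerivAt.const_mul _ ?_
        have := (hasDerivAt_pow (q + 1) t).div_const ((q + 1).factorial : ℝ)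
        convert this using 1
        rw [Nat.factorial_succ]
        push_cast
        field_simp
    have hK : 0 ≤ K := (abs_nonneg u).trans hu
    have hb : ∀ t ∈ Set.Icc (-K) K, ‖φ 1 (x + t) -
        ∑ q ∈ Finset.range N, φ (q + 1) x * (t ^ q / (q.factorial : ℝ))‖ ≤ ε * K ^ N := fun t ht =>
      ih (fun q => φ (q + 1)) (fun q hq t => hφ (q + 1) (by omega) t) hε t (abs_le.2 ht)
    have h0 : ψ 0 = 0 := by
      simp only [hψ]
      rw [Finset.sum_range_succ']
      simp
    -- Each order costs one factor `K` by the mean value inequality; the factorial gain is not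
    -- needed.
    have hmv := (convex_Icc (-K) K).norm_image_sub_le_of_norm_hasDerivWithin_le
      (fun t _ => (hder t).hasDerivWithinAt) hb (x := 0) (y := u) ⟨by linarith, hK⟩ (abs_le.1 hu)
    rw [h0, sub_zero, sub_zero] at hmv
    refine hmv.trans ?_
    have hεN : 0 ≤ ε * K ^ N := (norm_nonneg _).trans (hb 0 ⟨by linarith, hK⟩)
    rw [pow_succ, ← mul_assoc]
    exact mul_le_mul_of_nonneg_left hu hεN

/-! ### Independence of the order at infinity -/

/-- The filter of points whose largest coordinate tends to infinity. -/
def atMaxTop (p : ℕ) : Filter (Fin p → ℝ) := comap (fun x : Fin p → ℝ => ⨆ r, x r) atTop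

lemma eventually_atMaxTop {P : (Fin p → ℝ) → Prop} (hp : 1 ≤ p) :
    (∀ᶠ x in atMaxTop p, P x) ↔ ∃ b : ℝ, ∀ x, (∃ r, b ≤ x r) → P x := by
  have : Nonempty (Fin p) := ⟨⟨0, hp⟩⟩
  have hsup : ∀ (x : Fin p → ℝ) (b : ℝ), b ≤ ⨆ r, x r ↔ ∃ r, b ≤ x r := by
    intro x b
    constructor
    · intro h
      obtain ⟨r, hr⟩ := exists_eq_ciSup_of_finite (f := x)
      exact ⟨r, hr ▸ h⟩
    · rintro ⟨r, hr⟩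
      exact hr.trans (le_ciSup (Set.finite_range x).bddAbove r)
  rw [atMaxTop, (atTop_basis.comap _).eventually_iff]
  simp only [true_and, Set.mem_preimage, Set.mem_Ici, hsup]

lemma tendsto_add_atMaxTop (hp : 1 ≤ p) (y : Fin p → ℝ) :
    Tendsto (fun x => x + y) (atMaxTop p) (atMaxTop p) := by
  intro s hs
  obtain ⟨b, hb⟩ := (eventually_atMaxTop hp (P := fun x => x ∈ s)).1 hs
  refine (eventually_atMaxTop hp).2 ⟨b + ‖y‖, fun x ⟨r, hr⟩ => hb _ ⟨r, ?_⟩⟩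
  have := (abs_le.1 (norm_le_pi_norm y r)).1
  simp only [Pi.add_apply]
  linarith

/-- One coordinate tending to infinity suffices, which is why exactly `J = ∅` is excluded. -/
lemma tendsto_restrict (hp : 1 ≤ p) {J : Finset (Fin p)} (hJ : J.Nonempty) :
    Tendsto (fun n => restrict n J) atTop (atMaxTop p) := by
  intro s hs
  obtain ⟨b, hb⟩ := (eventually_atMaxTop hp (P := fun x => x ∈ s)).1 hs
  obtain ⟨r, hr⟩ := hJ
  refine mem_map.2 ((eventually_ge_atTop fun _ => ⌈b⌉₊).mono fun n hn => hb _ ⟨r, ?_⟩)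
  simp only [restrict, if_pos hr]
  exact (Nat.le_ceil b).trans (by exact_mod_cast hn r)

/-- The ideal of the operators that map `F` to a function vanishing at infinity. -/
def vanishingIdeal (hp : 1 ≤ p) (F : (Fin p → ℝ) → ℝ) :
    Ideal (AddMonoidAlgebra ℝ (Fin p → ℝ)) where
  carrier := {a | Tendsto (act a F) (atMaxTop p) (𝓝 0)}
  add_mem' {a b} ha hb := by
    have : act (a + b) F = fun x => act a F x + act b F x := by ext x; rw [act_add]
    simp only [Set.mem_ofPred_eq] at ha hb ⊢
    rw [this]
    simpa only [add_zero] using ha.add hb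
  zero_mem' := by
    simp only [Set.mem_ofPred_eq, map_zero, LinearMap.zero_apply]
    exact tendsto_const_nhds
  smul_mem' a b hb := by
    simp only [Set.mem_ofPred_eq, smul_eq_mul] at hb ⊢
    -- By linearity it suffices to multiply by a single translation, which preserves the filter.
    induction a using AddMonoidAlgebra.induction_linear with
    | zero =>
      simp only [zero_mul, map_zero, LinearMap.zero_apply]
      exact tendsto_const_nhds
    | add a a' h h' =>
      have : act ((a + a') * b) F = fun x => act (a * b) F x + act (a' * b) F x := by
        ext x; rw [add_mul, act_add]
      rw [this]
      simpa only [add_zero] using h.add h'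
    | single y w =>
      have h1 : AddMonoidAlgebra.single y w = w • trans y := by simp [trans]
      have h2 : act (AddMonoidAlgebra.single y w * b) F = fun x => w * act b F (x + y) := by
        ext x
        rw [h1, smul_mul_assoc, act_smul, act_mul, act_trans]
      rw [h2]
      simpa using (hb.comp (tendsto_add_atMaxTop hp y)).const_mul w

lemma mem_vanishingIdeal {hp : 1 ≤ p} {F : (Fin p → ℝ) → ℝ}
    {a : AddMonoidAlgebra ℝ (Fin p → ℝ)} :
    a ∈ vanishingIdeal hp F ↔ Tendsto (act a F) (atMaxTop p) (𝓝 0) := Iff.rfl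

lemma act_trans₁ (r : Fin p) (t : ℝ) (G : (Fin p → ℝ) → ℝ) (x : Fin p → ℝ) :
    act (trans₁ r t) G x = G (Function.update x r (x r + t)) := by
  rw [trans₁, act_trans]
  congr 1
  ext i
  by_cases h : i = r
  · subst h; simp
  · simp [h]

lemma act_avg₁ (m : ℕ) (r : Fin p) (G : (Fin p → ℝ) → ℝ) (x : Fin p → ℝ) :
    act (avg₁ m r) G x = ∑ j ∈ Finset.Icc 1 m, gammaOne m j * ∑ i ∈ Finset.range j,
      G (Function.update x r (x r + (-1 + (j : ℝ) / 2 - (i : ℝ)))) := by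
  rw [avg₁, act_sum]
  refine Finset.sum_congr rfl fun j _ => ?_
  rw [act_smul, act_sum]
  simp only [act_trans₁]

/-- The one-dimensional averages approximate the Taylor polynomial. -/
lemma abs_sum_gammaOne_sub_le (m N : ℕ) (φ : ℕ → ℝ → ℝ)
    (hφ : ∀ q < N, ∀ t, HasDerivAt (φ q) (φ (q + 1) t) t) (x ε : ℝ)
    (hε : ∀ t, |t| ≤ (m : ℝ) + 1 → |φ N (x + t)| ≤ ε) :
    |∑ j ∈ Finset.Icc 1 m, gammaOne m j * ∑ i ∈ Finset.range j,
        φ 0 (x + (-1 + (j : ℝ) / 2 - (i : ℝ))) -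
      ∑ q ∈ Finset.range N, φ q x / (q.factorial : ℝ) * shiftMoment m q| ≤
      (∑ j ∈ Finset.Icc 1 m, |gammaOne m j| * j) * (ε * ((m : ℝ) + 1) ^ N) := by
  have h1 : ∑ q ∈ Finset.range N, φ q x / (q.factorial : ℝ) * shiftMoment m q =
      ∑ j ∈ Finset.Icc 1 m, gammaOne m j * ∑ i ∈ Finset.range j,
        ∑ q ∈ Finset.range N, φ q x * ((-1 + (j : ℝ) / 2 - (i : ℝ)) ^ q / (q.factorial : ℝ)) := by
    simp only [shiftMoment, Finset.mul_sum]
    rw [Finset.sum_comm]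
    refine Finset.sum_congr rfl fun j _ => ?_
    rw [Finset.sum_comm]
    exact Finset.sum_congr rfl fun i _ => Finset.sum_congr rfl fun q _ => by ring
  rw [h1, ← Finset.sum_sub_distrib, Finset.sum_mul]
  refine (Finset.abs_sum_le_sum_abs _ _).trans (Finset.sum_le_sum fun j hj => ?_)
  rw [← mul_sub, abs_mul, ← Finset.sum_sub_distrib, mul_assoc]
  refine mul_le_mul_of_nonneg_left ?_ (abs_nonneg _)
  refine (Finset.abs_sum_le_sum_abs _ _).trans ?_
  have : (j : ℝ) * (ε * ((m : ℝ) + 1) ^ N) =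
      ∑ _i ∈ Finset.range j, ε * ((m : ℝ) + 1) ^ N := by simp
  rw [this]
  refine Finset.sum_le_sum fun i hi => ?_
  refine abs_sub_taylor_le N φ hφ x _ ε hε _ ?_
  -- The nodes lie in `[-m/2, m/2]`; the radius `m + 1` is a generous bound.
  have hi' : (i : ℝ) + 1 ≤ j := by exact_mod_cast Finset.mem_range.1 hi
  have hj' : (j : ℝ) ≤ m := by exact_mod_cast (Finset.mem_Icc.1 hj).2
  have hi0 : (0 : ℝ) ≤ i := Nat.cast_nonneg i
  rw [abs_le]
  constructor <;> linarith

/-- Both averages are close to the same combination of Taylor coefficients of `F` in direction `r`,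
with errors controlled by the pure derivative of order `2m₀` near the point. -/
lemma avg₁_sub_mem (hp : 1 ≤ p) {m m₀ : ℕ} (hm : m₀ ≤ m) (F G : (Fin p → ℝ) → ℝ) (r : Fin p)
    (hG : HasMixedPartial (Pi.single r (2 * m₀)) F G) (hG0 : Tendsto G (atMaxTop p) (𝓝 0)) :
    avg₁ m r - avg₁ m₀ r ∈ vanishingIdeal hp F := by
  obtain ⟨φ, h0, hN, hφ⟩ := hasIterPartial_replicate (hasIterPartial_of_pure hG)
  set C : ℝ := (∑ j ∈ Finset.Icc 1 m, |gammaOne m j| * j) * ((m : ℝ) + 1) ^ (2 * m₀) +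
    (∑ j ∈ Finset.Icc 1 m₀, |gammaOne m₀ j| * j) * ((m₀ : ℝ) + 1) ^ (2 * m₀) with hC
  have hC0 : 0 ≤ C := by positivity
  rw [mem_vanishingIdeal, Metric.tendsto_nhds]
  intro ε hε
  have hδ : 0 < ε / (C + 1) := by positivity
  obtain ⟨b, hb⟩ := (eventually_atMaxTop hp).1 ((Metric.tendsto_nhds.1 hG0) _ hδ)
  -- Moving coordinate `r` by at most `m + 1` leaves coordinate `s` above `b`, even when `s = r`.
  refine (eventually_atMaxTop hp).2 ⟨b + (m + 1), fun x ⟨s, hs⟩ => ?_⟩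
  have hbound : ∀ t, |t| ≤ (m : ℝ) + 1 →
      |φ (2 * m₀) (Function.update x r (x r + t))| ≤ ε / (C + 1) := by
    intro t ht
    rw [hN]
    suffices h : ∃ s, b ≤ Function.update x r (x r + t) s by
      simpa using (hb _ h).le
    refine ⟨s, ?_⟩
    have := (abs_le.1 ht).1
    by_cases h : s = r
    · subst h; simp; linarith
    · rw [Function.update_of_ne h]
      have : (0 : ℝ) ≤ m := Nat.cast_nonneg m
      linarith
  have hder : ∀ q < 2 * m₀, ∀ t, HasDerivAt (fun t => φ q (Function.update x r t))
      (φ (q + 1) (Function.update x r t)) t := by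
    intro q hq t
    have := hφ q hq (Function.update x r t)
    simpa using this
  have hm' : (m₀ : ℝ) ≤ m := by exact_mod_cast hm
  have b1 := abs_sum_gammaOne_sub_le m (2 * m₀) (fun q t => φ q (Function.update x r t)) hder
    (x r) _ hbound
  have b2 := abs_sum_gammaOne_sub_le m₀ (2 * m₀) (fun q t => φ q (Function.update x r t)) hder
    (x r) _ fun t ht => hbound t (ht.trans (by linarith))
  have e : ∑ q ∈ Finset.range (2 * m₀), φ q (Function.update x r (x r)) / (q.factorial : ℝ) *
      shiftMoment m q = ∑ q ∈ Finset.range (2 * m₀),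
      φ q (Function.update x r (x r)) / (q.factorial : ℝ) * shiftMoment m₀ q :=
    Finset.sum_congr rfl fun q hq => by
      rw [shiftMoment_eq m₀ m hm q (Finset.mem_range.1 hq)]
  rw [e] at b1
  rw [dist_zero_right, Real.norm_eq_abs, act_sub, act_avg₁, act_avg₁, ← h0]
  refine (abs_sub_le _ _ _).trans_lt (lt_of_le_of_lt (add_le_add b1 ((abs_sub_comm _ _).trans_le b2)) ?_)
  have : (∑ j ∈ Finset.Icc 1 m, |gammaOne m j| * (j : ℝ)) * (ε / (C + 1) * ((m : ℝ) + 1) ^ (2 * m₀)) +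
      (∑ j ∈ Finset.Icc 1 m₀, |gammaOne m₀ j| * (j : ℝ)) *
        (ε / (C + 1) * ((m₀ : ℝ) + 1) ^ (2 * m₀)) = C * (ε / (C + 1)) := by
    rw [hC]; ring
  rw [this, ← mul_div_assoc, div_lt_iff₀ (by positivity)]
  nlinarith

/-- Congruence modulo an ideal is multiplicative. Hence only pure derivatives of `F` are needed to
compare the `p`-dimensional averages. -/
lemma prod_sub_prod_mem {R ι : Type*} [CommRing R] (I : Ideal R) (s : Finset ι) (a b : ι → R)
    (h : ∀ i ∈ s, a i - b i ∈ I) : ∏ i ∈ s, a i - ∏ i ∈ s, b i ∈ I := by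
  simp only [← Ideal.Quotient.eq] at h ⊢
  rw [map_prod, map_prod]
  exact Finset.prod_congr rfl h

lemma tendsto_Atilde_sub (hp : 1 ≤ p) {m m₀ : ℕ} (hm : m₀ ≤ m) (F : (Fin p → ℝ) → ℝ)
    (hF0 : ∀ α : Fin p → ℕ, ∑ r, α r = 2 * m₀ →
      ∃ G : (Fin p → ℝ) → ℝ, HasMixedPartial α F G ∧ Tendsto G (atMaxTop p) (𝓝 0)) :
    Tendsto (fun n => Atilde m F n - Atilde m₀ F n) atTop (𝓝 0) := by
  have hmem : avg m - avg m₀ ∈ vanishingIdeal hp F := by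
    refine prod_sub_prod_mem _ _ _ _ fun r _ => ?_
    obtain ⟨G, hG, hG0⟩ := hF0 (Pi.single r (2 * m₀)) (by simp)
    exact avg₁_sub_mem hp hm F G r hG hG0
  have : (fun n => Atilde m F n - Atilde m₀ F n) = fun n =>
      ∑ J : Finset (Fin p) with J.Nonempty,
        (-1) ^ (p - J.card) * act (avg m - avg m₀) F (restrict n J) := by
    ext n
    rw [Atilde, Atilde, ← Finset.sum_sub_distrib]
    refine Finset.sum_congr rfl fun J _ => ?_
    rw [AJ_eq_act, AJ_eq_act, act_sub, mul_sub]
  rw [this]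
  have h0 : (0 : ℝ) = ∑ J : Finset (Fin p) with J.Nonempty, (-1) ^ (p - J.card) * 0 := by simp
  rw [h0]
  refine tendsto_finsetSum _ fun J hJ => Tendsto.const_mul _ ?_
  exact (mem_vanishingIdeal.1 hmem).comp (tendsto_restrict hp (Finset.mem_filter.1 hJ).2)

/-! ### Central differences as integrals over cubes -/

/-- The cube `[-1, 1]^p`. -/
def cube (p : ℕ) : Set (Fin p → ℝ) := Set.Icc (fun _ => (-1 : ℝ)) (fun _ => 1)

lemma isCompact_cube : IsCompact (cube p) := isCompact_Icc

lemma restrict_cube : (volume : Measure (Fin p → ℝ)).restrict (cube p) =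
    Measure.pi fun _ => (volume : Measure ℝ).restrict (Set.Icc (-1) 1) := by
  rw [cube, ← Set.pi_univ_Icc, volume_pi, Measure.restrict_pi_pi]

/-- Overwriting one coordinate by an independent copy preserves the product measure, up to the mass
`2` of the discarded coordinate. -/
lemma map_update_cube (r : Fin p) :
    Measure.map (fun z : (Fin p → ℝ) × ℝ => Function.update z.1 r z.2)
      (((volume : Measure (Fin p → ℝ)).restrict (cube p)).prod
        ((volume : Measure ℝ).restrict (Set.Icc (-1) 1))) =
      (2 : ENNReal) • (volume : Measure (Fin p → ℝ)).restrict (cube p) := by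
  have hmeas : Measurable fun z : (Fin p → ℝ) × ℝ => Function.update z.1 r z.2 := by
    refine measurable_pi_lambda _ fun i => ?_
    by_cases h : i = r
    · subst h; simpa using measurable_snd
    · simp only [Function.update_of_ne h]
      exact (measurable_pi_apply i).comp measurable_fst
  have h2 : (2 : ENNReal)⁻¹ * 2 = 1 := ENNReal.inv_mul_cancel (by simp) (by simp)
  rw [restrict_cube]
  set ν := (volume : Measure ℝ).restrict (Set.Icc (-1) 1) with hν
  have hν2 : ν Set.univ = 2 := by
    rw [hν, Measure.restrict_apply_univ, Real.volume_Icc]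
    norm_num
  suffices h : (2 : ENNReal)⁻¹ • Measure.map (fun z : (Fin p → ℝ) × ℝ => Function.update z.1 r z.2)
      ((Measure.pi fun _ => ν).prod ν) = Measure.pi fun _ => ν by
    rw [← h, smul_smul, mul_comm, h2, one_smul]
    rw [h]
  symm
  refine Measure.pi_eq fun s hs => ?_
  rw [Measure.smul_apply, Measure.map_apply hmeas (MeasurableSet.univ_pi hs)]
  have hpre : (fun z : (Fin p → ℝ) × ℝ => Function.update z.1 r z.2) ⁻¹' Set.univ.pi s =
      (Set.univ.pi (Function.update s r Set.univ)) ×ˢ s r := by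
    ext ⟨v, t⟩
    simp only [Set.mem_preimage, Set.mem_pi, Set.mem_univ, true_implies, Set.mem_prod]
    constructor
    · intro h
      refine ⟨fun i => ?_, by simpa using h r⟩
      by_cases hi : i = r
      · subst hi; simp
      · simpa [hi] using h i
    · rintro ⟨h, ht⟩ i
      by_cases hi : i = r
      · subst hi; simpa using ht
      · simpa [hi] using h i
  rw [hpre, Measure.prod_prod, Measure.pi_pi, ← Finset.mul_prod_erase _ _ (Finset.mem_univ r),
    ← Finset.mul_prod_erase Finset.univ (fun i => ν (s i)) (Finset.mem_univ r)]
  have e : ∏ i ∈ Finset.univ.erase r, ν (Function.update s r Set.univ i) =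
      ∏ i ∈ Finset.univ.erase r, ν (s i) :=
    Finset.prod_congr rfl fun i hi => by rw [Function.update_of_ne (Finset.ne_of_mem_erase hi)]
  rw [e, Function.update_self, hν2, smul_eq_mul, mul_assoc, ← mul_assoc, h2, one_mul, mul_comm]

lemma Continuous.integrable_prod_restrict {X Y : Type*} [MeasureSpace X] [MeasureSpace Y]
    [TopologicalSpace X] [TopologicalSpace Y] [OpensMeasurableSpace (X × Y)] [T2Space (X × Y)]
    [SFinite (volume : Measure X)] [SFinite (volume : Measure Y)]
    [IsFiniteMeasureOnCompacts ((volume : Measure X).prod (volume : Measure Y))]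
    {h : X × Y → ℝ} (hh : Continuous h) {s : Set X} {t : Set Y} (hs : IsCompact s)
    (ht : IsCompact t) :
    Integrable h (((volume : Measure X).restrict s).prod ((volume : Measure Y).restrict t)) := by
  rw [Measure.prod_restrict]
  exact hh.continuousOn.integrableOn_compact (hs.prod ht)

lemma integral_update_cube (r : Fin p) {h : (Fin p → ℝ) → ℝ} (hh : Continuous h) :
    ∫ v in cube p, ∫ t in Set.Icc (-1 : ℝ) 1, h (Function.update v r t) =
      2 * ∫ v in cube p, h v := by
  have hu : Continuous fun z : (Fin p → ℝ) × ℝ => Function.update z.1 r z.2 :=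
    continuous_fst.update r continuous_snd
  rw [← integral_prod (fun z : (Fin p → ℝ) × ℝ => h (Function.update z.1 r z.2))
    (Continuous.integrable_prod_restrict (hh.comp hu) isCompact_cube isCompact_Icc)]
  have := integral_map (μ := ((volume : Measure (Fin p → ℝ)).restrict (cube p)).prod
        ((volume : Measure ℝ).restrict (Set.Icc (-1) 1))) hu.measurable.aemeasurable
      (f := h) hh.aestronglyMeasurable
  rw [← this, map_update_cube, integral_smul_measure]
  simp

lemma HasDerivAt.act (a : AddMonoidAlgebra ℝ (Fin p → ℝ)) {r : Fin p} {G G' : (Fin p → ℝ) → ℝ}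
    (h : ∀ x, HasDerivAt (fun t : ℝ => G (Function.update x r t)) (G' x) (x r)) (x : Fin p → ℝ) :
    HasDerivAt (fun t : ℝ => act a G (Function.update x r t)) (act a G' x) (x r) := by
  induction a using AddMonoidAlgebra.induction_linear with
  | zero => simpa using hasDerivAt_const (x r) (0 : ℝ)
  | add a b ha hb => simp only [act_add]; exact ha.add hb
  | single y w =>
    have h1 : AddMonoidAlgebra.single y w = w • trans y := by simp [trans]
    simp only [h1, act_smul, act_trans]
    have h2 : ∀ t, Function.update x r t + y = Function.update (x + y) r (t + y r) := by
      intro t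
      ext i
      by_cases hi : i = r
      · subst hi; simp
      · simp [hi]
    simp only [h2]
    exact ((h (x + y)).comp_add_const (x r) (y r)).const_mul w

/-- The iterated central difference of a function is an integral of its iterated partial
derivative. -/
lemma act_prod_centralDiff_list (a : Fin p → ℝ) (l : List (Fin p)) (hl : l.Nodup)
    {G h : (Fin p → ℝ) → ℝ} (hG : HasIterPartial l G h) (hh : Continuous h) (x : Fin p → ℝ) :
    2 ^ p * act ((l.map fun r => centralDiff r (a r)).prod) G x =
      2 ^ l.length * (l.map a).prod *
        ∫ v in cube p, h (x + fun i => if i ∈ l then a i * v i else 0) := by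
  induction l generalizing G x with
  | nil =>
    obtain rfl : G = h := hG
    have hvol : (volume : Measure (Fin p → ℝ)).real (cube p) = 2 ^ p := by
      rw [cube, Measure.real, Real.volume_Icc_pi_toReal (fun i => by norm_num)]
      norm_num
    have h0 : (fun _ : Fin p => (0 : ℝ)) = 0 := rfl
    simp [hvol, h0]
  | cons r l ih =>
    obtain ⟨G', hd, hG'⟩ := hG
    obtain ⟨hr, hl⟩ := List.nodup_cons.1 hl
    have ih' := ih hl hG'
    set D := (l.map fun r => centralDiff r (a r)).prod with hD
    set c : ℝ := 2 ^ l.length * (l.map a).prod with hc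
    have hint : Continuous fun z : (Fin p → ℝ) × (Fin p → ℝ) =>
        h (z.1 + fun i => if i ∈ l then a i * z.2 i else 0) := by
      refine hh.comp (continuous_fst.add (continuous_pi fun i => ?_))
      split_ifs <;> fun_prop
    -- Intermediate derivatives are not assumed continuous; continuity after applying `D` is read
    -- off from the integral formula of the induction hypothesis.
    have hcont : Continuous fun x => act D G' x := by
      have h1 : (fun x => act D G' x) = fun x => (2 ^ p)⁻¹ * (c *
          ∫ v in cube p, h (x + fun i => if i ∈ l then a i * v i else 0)) := by
        ext x
        rw [← ih' x, inv_mul_cancel_left₀ (by positivity)]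
      rw [h1]
      exact continuous_const.mul (continuous_const.mul
        (continuous_parametric_integral_of_continuous hint isCompact_cube))
    have hpath : Continuous fun t : ℝ => Function.update x r (x r + a r * t) :=
      continuous_const.update r (by fun_prop)
    have hder : ∀ t : ℝ, HasDerivAt (fun t => act D G (Function.update x r (x r + a r * t)))
        (a r * act D G' (Function.update x r (x r + a r * t))) t := by
      intro t
      have h1 := HasDerivAt.act D hd (Function.update x r (x r + a r * t))
      simp only [Function.update_idem, Function.update_self] at h1
      have h2 : HasDerivAt (fun t : ℝ => x r + a r * t) (a r) t := by
        simpa using ((hasDerivAt_id t).const_mul (a r)).const_add (x r)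
      have := HasDerivAt.comp t h1 h2
      rwa [mul_comm] at this
    have hftc := intervalIntegral.integral_eq_sub_of_hasDerivAt (a := -1) (b := 1)
      (fun t _ => hder t) ((continuous_const.mul (hcont.comp hpath)).intervalIntegrable _ _)
    have hdiff : act (((r :: l).map fun r => centralDiff r (a r)).prod) G x =
        ∫ t in (-1 : ℝ)..1, a r * act D G' (Function.update x r (x r + a r * t)) := by
      rw [hftc, List.map_cons, List.prod_cons, act_mul, centralDiff, act_sub, act_trans₁, act_trans₁]
      simp [hD]
    have hL : ∫ t in (-1 : ℝ)..1, a r * act D G' (Function.update x r (x r + a r * t)) =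
        (2 ^ p)⁻¹ * (a r * c * ∫ t in Set.Icc (-1 : ℝ) 1, ∫ v in cube p,
          h (Function.update x r (x r + a r * t) + fun i => if i ∈ l then a i * v i else 0)) := by
      rw [intervalIntegral.integral_of_le (by norm_num), ← integral_Icc_eq_integral_Ioc,
        ← integral_const_mul, ← integral_const_mul]
      refine integral_congr_ae (Eventually.of_forall fun t => ?_)
      simp only
      rw [mul_assoc (a r), ← ih']
      field_simp
    -- Since `r ∉ l`, the inner integrand ignores `v r`, so `t` can take its place. The factor `2`
    -- matches the power of `2` in the statement, which counts the coordinates already used.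
    have hswap : ∫ t in Set.Icc (-1 : ℝ) 1, ∫ v in cube p,
          h (Function.update x r (x r + a r * t) + fun i => if i ∈ l then a i * v i else 0) =
        2 * ∫ v in cube p, h (x + fun i => if i ∈ r :: l then a i * v i else 0) := by
      have hc2 : Continuous fun v : Fin p → ℝ =>
          h (x + fun i => if i ∈ r :: l then a i * v i else 0) := by
        refine hh.comp (continuous_const.add (continuous_pi fun i => ?_))
        split_ifs <;> fun_prop
      rw [← integral_update_cube r hc2, integral_integral_swap]
      · refine integral_congr_ae (Eventually.of_forall fun t => ?_)
        refine integral_congr_ae (Eventually.of_forall fun v => ?_)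
        simp only
        congr 1
        ext i
        by_cases hi : i = r
        · subst hi; simp [hr]
        · simp [hi]
      · refine Continuous.integrable_prod_restrict ?_ isCompact_Icc isCompact_cube
        exact hint.comp ((hpath.comp continuous_fst).prodMk continuous_snd)
    rw [hdiff, hL, hswap, List.length_cons, List.map_cons, List.prod_cons, hc,
      mul_inv_cancel_left₀ (by positivity)]
    ring

lemma act_prod_centralDiff (a : Fin p → ℝ) {G g : (Fin p → ℝ) → ℝ} (hG : IsAntiderivative G g)
    (hg : Continuous g) (x : Fin p → ℝ) :
    act (∏ r, centralDiff r (a r)) G x = (∏ r, a r) * ∫ v in cube p, g (x + fun i => a i * v i) := by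
  obtain ⟨l, hl, hG⟩ := hG
  have hperm : l.Perm (List.finRange p) := by
    rw [List.perm_iff_count]
    intro r
    rw [hl r, List.count_eq_one_of_mem (List.nodup_finRange p) (List.mem_finRange r)]
  have h := act_prod_centralDiff_list a l (hperm.nodup_iff.2 (List.nodup_finRange p)) hG hg x
  have hmem : ∀ i, i ∈ l := fun i => hperm.mem_iff.2 (List.mem_finRange i)
  rw [(hperm.map _).prod_eq, (hperm.map _).prod_eq, hperm.length_eq, List.length_finRange,
    ← Fin.prod_univ_def, ← Fin.prod_univ_def, mul_assoc] at h
  simp only [hmem, if_true] at h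
  exact mul_left_cancel₀ (by positivity) h

/-! ### Mixed partial derivatives and the multivariate Taylor formula -/

lemma hasDerivAt_comp_update {g : (Fin p → ℝ) → ℝ} (hg : Differentiable ℝ g) (r : Fin p)
    (x : Fin p → ℝ) :
    HasDerivAt (fun t : ℝ => g (Function.update x r t)) (fderiv ℝ g x (Pi.single r 1)) (x r) := by
  have h := (hg (Function.update x r (x r))).hasFDerivAt.comp_hasDerivAt (x r)
    (_root_.hasDerivAt_update x r (x r))
  rw [Function.update_eq_self] at h
  exact h

lemma pderiv_eq {g : (Fin p → ℝ) → ℝ} (hg : Differentiable ℝ g) (r : Fin p) :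
    pderiv r g = fun x => fderiv ℝ g x (Pi.single r 1) := by
  ext x
  exact (hasDerivAt_comp_update hg r x).deriv

lemma contDiff_pderiv {g : (Fin p → ℝ) → ℝ} {n : ℕ} (hg : ContDiff ℝ (n + 1 : ℕ) g) (r : Fin p) :
    ContDiff ℝ n (pderiv r g) := by
  rw [pderiv_eq (hg.differentiable (by simp))]
  exact (hg.fderiv_right (m := (n : WithTop ℕ∞)) (by push_cast; exact le_rfl)).clm_apply
    contDiff_const

lemma pderiv_comm {g : (Fin p → ℝ) → ℝ} (hg : ContDiff ℝ 2 g) (r s : Fin p) :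
    pderiv r (pderiv s g) = pderiv s (pderiv r g) := by
  have hg' : ContDiff ℝ ((1 + 1 : ℕ) : WithTop ℕ∞) g := by exact_mod_cast hg
  have hd : Differentiable ℝ g := hg.differentiable (by simp)
  have hdd : Differentiable ℝ (fderiv ℝ g) :=
    (hg.fderiv_right (m := 1) (by norm_num)).differentiable (by simp)
  have key : ∀ r s : Fin p, pderiv r (pderiv s g) = fun x =>
      fderiv ℝ (fderiv ℝ g) x (Pi.single r 1) (Pi.single s 1) := by
    intro r s
    have h1 : Differentiable ℝ (pderiv s g) :=
      (contDiff_pderiv hg' s).differentiable (by simp)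
    rw [pderiv_eq h1]
    ext x
    rw [pderiv_eq hd, fderiv_clm_apply (hdd x) (differentiableAt_const _)]
    simp
  rw [key, key]
  ext x
  exact (hg.contDiffAt.isSymmSndFDerivAt (by simp)) _ _

lemma contDiff_foldl_pderiv {n : ℕ} (l : List (Fin p)) {g : (Fin p → ℝ) → ℝ}
    (hg : ContDiff ℝ ((n + l.length : ℕ) : WithTop ℕ∞) g) :
    ContDiff ℝ n (l.foldl (fun h r => pderiv r h) g) := by
  induction l generalizing g with
  | nil => simpa using hg
  | cons r l ih =>
    exact ih (contDiff_pderiv (by simpa [add_assoc] using hg) r)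

lemma foldl_pderiv_perm {l l' : List (Fin p)} (h : l.Perm l') {g : (Fin p → ℝ) → ℝ}
    (hg : ContDiff ℝ (l.length : WithTop ℕ∞) g) :
    l.foldl (fun h r => pderiv r h) g = l'.foldl (fun h r => pderiv r h) g := by
  induction h generalizing g with
  | nil => rfl
  | cons r _ ih => exact ih (contDiff_pderiv (by simpa using hg) r)
  | swap r s l =>
    simp only [List.foldl_cons]
    rw [pderiv_comm]
    refine hg.of_le ?_
    simp only [List.length_cons]
    push_cast
    rw [add_assoc]
    norm_num
  | trans h1 _ ih1 ih2 => rw [ih1 hg, ih2 (h1.length_eq ▸ hg)]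

/-- The list of differentiations in `mixedPartial α`. -/
def derivList (α : Fin p → ℕ) : List (Fin p) :=
  (List.finRange p).flatMap fun r => List.replicate (α r) r

lemma mixedPartial_eq_foldl (α : Fin p → ℕ) (g : (Fin p → ℝ) → ℝ) :
    mixedPartial α g = (derivList α).foldl (fun h r => pderiv r h) g := rfl

lemma length_derivList (α : Fin p → ℕ) : (derivList α).length = ∑ r, α r := by
  rw [derivList, List.length_flatMap, Fin.sum_univ_def]
  simp

lemma count_derivList (α : Fin p → ℕ) (s : Fin p) : (derivList α).count s = α s := by
  rw [derivList, List.count_flatMap]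
  have : (List.map (List.count s ∘ fun r => List.replicate (α r) r) (List.finRange p)).sum =
      ∑ r, if r = s then α r else 0 := by
    rw [Fin.sum_univ_def]
    congr 2
    ext r
    simp [List.count_replicate]
  rw [this]
  simp

lemma mixedPartial_zero (g : (Fin p → ℝ) → ℝ) : mixedPartial 0 g = g := by
  have : derivList (0 : Fin p → ℕ) = [] := List.length_eq_zero_iff.1 (by simp [length_derivList])
  rw [mixedPartial_eq_foldl, this]
  rfl

lemma contDiff_mixedPartial {n : ℕ} (α : Fin p → ℕ) {g : (Fin p → ℝ) → ℝ}
    (hg : ContDiff ℝ ((n + ∑ r, α r : ℕ) : WithTop ℕ∞) g) : ContDiff ℝ n (mixedPartial α g) :=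
  contDiff_foldl_pderiv (derivList α) (by rwa [length_derivList])

lemma pderiv_mixedPartial (α : Fin p → ℕ) {g : (Fin p → ℝ) → ℝ} (r : Fin p)
    (hg : ContDiff ℝ ((∑ r, α r + 1 : ℕ) : WithTop ℕ∞) g) :
    pderiv r (mixedPartial α g) = mixedPartial (α + Pi.single r 1) g := by
  have h1 : pderiv r (mixedPartial α g) =
      (derivList α ++ [r]).foldl (fun h r => pderiv r h) g := by
    rw [List.foldl_append]; rfl
  rw [h1, mixedPartial_eq_foldl]
  refine foldl_pderiv_perm ?_ (by simpa [length_derivList] using hg)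
  rw [List.perm_iff_count]
  intro s
  rw [List.count_append, count_derivList, count_derivList]
  by_cases h : s = r
  · subst h; simp
  · simp [h, Ne.symm h]

lemma hasDerivAt_line {g : (Fin p → ℝ) → ℝ} (hg : Differentiable ℝ g) (x h : Fin p → ℝ) (s : ℝ) :
    HasDerivAt (fun s : ℝ => g (x + s • h)) (∑ r, h r * pderiv r g (x + s • h)) s := by
  have h1 : HasDerivAt (fun s : ℝ => x + s • h) h s := by
    simpa using ((hasDerivAt_id s).smul_const h).const_add x
  have h2 := (hg (x + s • h)).hasFDerivAt.comp_hasDerivAt s h1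
  refine h2.congr_deriv ?_
  conv_lhs => arg 2; rw [← Finset.univ_sum_single h]
  rw [map_sum]
  refine Finset.sum_congr rfl fun r _ => ?_
  rw [pderiv_eq hg]
  have : (Pi.single r (h r) : Fin p → ℝ) = h r • Pi.single r 1 := by
    rw [← Pi.single_smul]; simp
  rw [this, map_smul, smul_eq_mul]

lemma prod_factorial_add_single (α : Fin p → ℕ) (r : Fin p) :
    ∏ i, (((α + Pi.single r 1 : Fin p → ℕ) i).factorial : ℝ) = ((α r : ℝ) + 1) * ∏ i, ((α i).factorial : ℝ) := by
  rw [← Finset.mul_prod_erase _ _ (Finset.mem_univ r),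
    ← Finset.mul_prod_erase Finset.univ (fun i => ((α i).factorial : ℝ)) (Finset.mem_univ r)]
  have : ∏ i ∈ Finset.univ.erase r, (((α + Pi.single r 1 : Fin p → ℕ) i).factorial : ℝ) =
      ∏ i ∈ Finset.univ.erase r, ((α i).factorial : ℝ) :=
    Finset.prod_congr rfl fun i hi => by simp [Finset.ne_of_mem_erase hi]
  rw [this, ← mul_assoc]
  congr 1
  simp [Nat.factorial_succ]

/-- Write `q + 1` as the sum of the `β r` and use `β r / β! = 1 / (β - e_r)!`. Indices with `β r =
0` are not of the form `α + e_r`, but they contribute zero. -/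
lemma sum_piAntidiag_succ (q : ℕ) (H : (Fin p → ℕ) → ℝ) :
    ∑ α ∈ Finset.piAntidiag (Finset.univ : Finset (Fin p)) q,
      ∑ r, 1 / (∏ i, ((α i).factorial : ℝ)) * H (α + Pi.single r 1) =
    ((q : ℝ) + 1) * ∑ β ∈ Finset.piAntidiag (Finset.univ : Finset (Fin p)) (q + 1),
      1 / (∏ i, ((β i).factorial : ℝ)) * H β := by
  have h1 : ((q : ℝ) + 1) * ∑ β ∈ Finset.piAntidiag (Finset.univ : Finset (Fin p)) (q + 1),
      1 / (∏ i, ((β i).factorial : ℝ)) * H β =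
      ∑ β ∈ Finset.piAntidiag (Finset.univ : Finset (Fin p)) (q + 1),
      ∑ r, (β r : ℝ) * (1 / (∏ i, ((β i).factorial : ℝ)) * H β) := by
    rw [Finset.mul_sum]
    refine Finset.sum_congr rfl fun β hβ => ?_
    rw [← Finset.sum_mul]
    congr 1
    have := (Finset.mem_piAntidiag.1 hβ).1
    exact_mod_cast this.symm
  rw [h1, Finset.sum_comm, Finset.sum_comm (s := Finset.piAntidiag _ (q + 1))]
  refine Finset.sum_congr rfl fun r _ => ?_
  refine Finset.sum_of_injOn (fun α => α + Pi.single r 1) (fun _ _ _ _ h => add_right_cancel h)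
    ?_ ?_ ?_
  · intro α hα
    have hα' := (Finset.mem_piAntidiag.1 hα).1
    simp only [Finset.mem_coe, Finset.mem_piAntidiag, Pi.add_apply, Finset.sum_add_distrib]
    simp [hα']
  · intro β hβ hnot
    have : β r = 0 := by
      by_contra hne
      refine hnot ⟨β - Pi.single r 1, ?_, ?_⟩
      · have hsum := (Finset.mem_piAntidiag.1 hβ).1
        have hle : ∀ i, (Pi.single r 1 : Fin p → ℕ) i ≤ β i := by
          intro i
          by_cases h : i = r
          · subst h; simp; omega
          · simp [h]
        simp only [Finset.mem_coe, Finset.mem_piAntidiag, Pi.sub_apply]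
        refine ⟨?_, by simp⟩
        rw [Finset.sum_tsub_distrib _ fun i _ => hle i, hsum]
        simp
      · ext i
        by_cases h : i = r
        · subst h; simp; omega
        · simp [h]
    simp [this]
  · intro α _
    rw [prod_factorial_add_single]
    have h2 : ∏ i, ((α i).factorial : ℝ) ≠ 0 :=
      Finset.prod_ne_zero_iff.2 fun i _ => by exact_mod_cast (Nat.factorial_pos _).ne'
    have h3 : (α r : ℝ) + 1 ≠ 0 := by positivity
    simp only [Pi.add_apply, Pi.single_eq_same]
    push_cast
    field_simp

/-- The `q`-th derivative of `s ↦ g(x + s h)`, divided by `q!`. -/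
def lineCoeff (g : (Fin p → ℝ) → ℝ) (x h : Fin p → ℝ) (q : ℕ) (s : ℝ) : ℝ :=
  ∑ α ∈ Finset.piAntidiag (Finset.univ : Finset (Fin p)) q,
    1 / (∏ i, ((α i).factorial : ℝ)) * ((∏ i, h i ^ α i) * mixedPartial α g (x + s • h))

lemma hasDerivAt_lineCoeff {g : (Fin p → ℝ) → ℝ} {q : ℕ}
    (hg : ContDiff ℝ ((q + 1 : ℕ) : WithTop ℕ∞) g) (x h : Fin p → ℝ) (s : ℝ) :
    HasDerivAt (lineCoeff g x h q) (((q : ℝ) + 1) * lineCoeff g x h (q + 1) s) s := by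
  rw [lineCoeff, ← sum_piAntidiag_succ q fun β =>
    (∏ i, h i ^ β i) * mixedPartial β g (x + s • h)]
  refine HasDerivAt.fun_sum fun α hα => ?_
  have hα' := (Finset.mem_piAntidiag.1 hα).1
  have hd : Differentiable ℝ (mixedPartial α g) := by
    refine (contDiff_mixedPartial (n := 1) α ?_).differentiable (by simp)
    rwa [hα', add_comm]
  have := ((hasDerivAt_line hd x h s).const_mul (∏ i, h i ^ α i)).const_mul
    (1 / (∏ i, ((α i).factorial : ℝ)))
  refine this.congr_deriv ?_
  rw [Finset.mul_sum, Finset.mul_sum]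
  refine Finset.sum_congr rfl fun r _ => ?_
  rw [pderiv_mixedPartial α r (by rwa [hα'])]
  have hp : ∏ i, h i ^ (α + Pi.single r 1 : Fin p → ℕ) i = (∏ i, h i ^ α i) * h r := by
    simp only [Pi.add_apply, pow_add, Finset.prod_mul_distrib]
    congr 1
    rw [Finset.prod_eq_single r (fun i _ hi => by simp [hi]) (by simp)]
    simp
  rw [hp]
  ring

/-- Taylor's formula with the remainder in integral form, for functions given together with
their normalized derivatives `a q = φ^{(q)} / q!`. -/
lemma taylor_integral (a : ℕ → ℝ → ℝ) (N : ℕ)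
    (ha : ∀ q < N + 1, ∀ s, HasDerivAt (a q) (((q : ℝ) + 1) * a (q + 1) s) s)
    (hc : Continuous (a (N + 1))) :
    a 0 1 = ∑ q ∈ Finset.range (N + 1), a q 0 +
      ((N : ℝ) + 1) * ∫ s in (0 : ℝ)..1, (1 - s) ^ N * a (N + 1) s := by
  induction N with
  | zero =>
    have := intervalIntegral.integral_eq_sub_of_hasDerivAt (a := 0) (b := 1)
      (fun t _ => ha 0 (by norm_num) t) ((continuous_const.mul hc).intervalIntegrable _ _)
    simp only [CharP.cast_eq_zero, zero_add, one_mul] at this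
    simp [this]
  | succ N ih =>
    have hcN : Continuous (a (N + 1)) :=
      continuous_iff_continuousAt.2 fun s => (ha (N + 1) (by omega) s).continuousAt
    rw [ih (fun q hq => ha q (by omega)) hcN, Finset.sum_range_succ _ (N + 1), add_assoc]
    congr 1
    -- Integration by parts with this primitive: its boundary value at `0` produces the next Taylor
    -- coefficient.
    have hu : ∀ s : ℝ, HasDerivAt (fun s : ℝ => -(1 - s) ^ (N + 1))
        (((N : ℝ) + 1) * (1 - s) ^ N) s := by
      intro s
      have h1 := (((hasDerivAt_id s).const_sub 1).pow (N + 1)).neg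
      refine h1.congr_deriv ?_
      simp
    have hparts := intervalIntegral.integral_mul_deriv_eq_deriv_mul (a := 0) (b := 1)
      (fun s _ => hu s) (fun s _ => ha (N + 1) (by omega) s)
      (Continuous.intervalIntegrable (by fun_prop) _ _)
      ((continuous_const.mul hc).intervalIntegrable _ _)
    have e1 : ∫ s in (0 : ℝ)..1, -(1 - s) ^ (N + 1) * ((((N + 1 : ℕ) : ℝ) + 1) * a (N + 1 + 1) s) =
        -((((N + 1 : ℕ) : ℝ) + 1) * ∫ s in (0 : ℝ)..1, (1 - s) ^ (N + 1) * a (N + 1 + 1) s) := by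
      rw [← intervalIntegral.integral_const_mul, ← intervalIntegral.integral_neg]
      congr 1
      ext s
      ring
    have e2 : ∫ s in (0 : ℝ)..1, ((N : ℝ) + 1) * (1 - s) ^ N * a (N + 1) s =
        ((N : ℝ) + 1) * ∫ s in (0 : ℝ)..1, (1 - s) ^ N * a (N + 1) s := by
      rw [← intervalIntegral.integral_const_mul]
      congr 1
      ext s
      ring
    rw [e1, e2] at hparts
    simp only [sub_self, ne_eq, Nat.add_eq_zero_iff, one_ne_zero, and_false, not_false_eq_true,
      zero_pow, neg_zero, zero_mul, sub_zero, one_pow, neg_mul, one_mul, zero_sub, neg_neg] at hparts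
    linarith

/-- The multivariate Taylor formula with the remainder in integral form. -/
lemma taylor_multivariate {g : (Fin p → ℝ) → ℝ} {m : ℕ} (hm : 1 ≤ m)
    (hg : ContDiff ℝ ((2 * m : ℕ) : WithTop ℕ∞) g) (x h : Fin p → ℝ) :
    g (x + h) = ∑ q ∈ Finset.range (2 * m), lineCoeff g x h q 0 +
      2 * (m : ℝ) * ∫ s in (0 : ℝ)..1, (1 - s) ^ (2 * m - 1) * lineCoeff g x h (2 * m) s := by
  obtain ⟨N, hN⟩ : ∃ N, 2 * m = N + 1 := ⟨2 * m - 1, by omega⟩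
  have hN' : 2 * (m : ℝ) = (N : ℝ) + 1 := by exact_mod_cast hN
  rw [hN', hN, Nat.add_sub_cancel, ← taylor_integral (lineCoeff g x h) N]
  · simp [lineCoeff, mixedPartial_zero]
  · exact fun q hq s => hasDerivAt_lineCoeff (hg.of_le (by exact_mod_cast (by omega))) x h s
  · refine continuous_finsetSum _ fun α hα => ?_
    have hα' := (Finset.mem_piAntidiag.1 hα).1
    have hc : Continuous (mixedPartial α g) :=
      (contDiff_mixedPartial (n := 0) α (by rwa [hα', zero_add, ← hN])).continuous
    fun_prop

/-! ### The quadrature error at a point -/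

lemma sum_gammaOne_mul_integral_pow {m : ℕ} {a : ℕ} (ha : a < 2 * m) :
    ∑ j ∈ Finset.Icc 1 m, gammaOne m j * (((j : ℝ) / 2) ^ (a + 1) *
      ∫ t in Set.Icc (-1 : ℝ) 1, t ^ a) = if a = 0 then 1 else 0 := by
  rw [integral_Icc_eq_integral_Ioc, ← intervalIntegral.integral_of_le (by norm_num), integral_pow]
  rcases Nat.even_or_odd' a with ⟨k, rfl | rfl⟩
  · have h := sum_gammaOne_mul_pow m k (by omega)
    have : ∀ j ∈ Finset.Icc 1 m, gammaOne m j * (((j : ℝ) / 2) ^ (2 * k + 1) *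
        ((1 ^ (2 * k + 1) - (-1) ^ (2 * k + 1)) / (((2 * k : ℕ) : ℝ) + 1))) =
        ((1 / 2) ^ (2 * k) / (((2 * k : ℕ) : ℝ) + 1)) *
          (gammaOne m j * (j : ℝ) ^ (2 * k + 1)) := by
      intro j _
      rw [Odd.neg_pow ⟨k, rfl⟩, div_pow, div_pow, pow_succ (2 : ℝ)]
      simp only [one_pow]
      field_simp
      ring
    rw [Finset.sum_congr rfl this, ← Finset.mul_sum, h]
    rcases k with _ | k <;> simp
  · have : (-1 : ℝ) ^ (2 * k + 1 + 1) = 1 := Even.neg_one_pow ⟨k + 1, by ring⟩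
    simp [this]

lemma integral_cube_monomial (α : Fin p → ℕ) :
    ∫ v in cube p, ∏ r, v r ^ α r = ∏ r, ∫ t in Set.Icc (-1 : ℝ) 1, t ^ α r := by
  rw [restrict_cube]
  exact integral_fintype_prod_eq_prod fun r (t : ℝ) => t ^ α r

/-- The sum factors over coordinates, and each factor is `1` or `0` according to whether `α r`
vanishes. So the weighted box integrals are exact on polynomials of degree below `2m`. -/
lemma sum_gammaCoeff_mul_integral {m : ℕ} {α : Fin p → ℕ}
    (hα : ∑ r, α r < 2 * m) :
    ∑ j ∈ indexBox p m, gammaCoeff m j * ((∏ r, ((j r : ℝ) / 2) ^ (α r + 1)) *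
      ∫ v in cube p, ∏ r, v r ^ α r) = if α = 0 then 1 else 0 := by
  have h1 : ∀ j ∈ indexBox p m, gammaCoeff m j * ((∏ r, ((j r : ℝ) / 2) ^ (α r + 1)) *
      ∫ v in cube p, ∏ r, v r ^ α r) = ∏ r, (gammaOne m (j r) * (((j r : ℝ) / 2) ^ (α r + 1) *
        ∫ t in Set.Icc (-1 : ℝ) 1, t ^ α r)) := by
    intro j _
    rw [integral_cube_monomial, gammaCoeff, Finset.prod_mul_distrib, Finset.prod_mul_distrib]
  rw [Finset.sum_congr rfl h1, indexBox, ← Finset.prod_univ_sum (fun _ => Finset.Icc 1 m)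
    (fun r j => gammaOne m j * (((j : ℝ) / 2) ^ (α r + 1) *
        ∫ t in Set.Icc (-1 : ℝ) 1, t ^ α r))]
  have h2 : ∀ r ∈ Finset.univ, ∑ j ∈ Finset.Icc 1 m, gammaOne m j * (((j : ℝ) / 2) ^ (α r + 1) *
        ∫ t in Set.Icc (-1 : ℝ) 1, t ^ α r) = if α r = 0 then 1 else 0 := fun r hr =>
    sum_gammaOne_mul_integral_pow
      ((Finset.single_le_sum (f := α) (fun i _ => Nat.zero_le _) hr).trans_lt hα)
  rw [Finset.prod_congr rfl h2, Finset.prod_ite_zero]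
  simp [funext_iff]

/-- The integral `∫_0^1 (1 - s)^N ∫_{[-1,1]^p} v^α Φ(s, v) dv ds`. -/
def weightedIntegral (N : ℕ) (α : Fin p → ℕ) (Φ : ℝ → (Fin p → ℝ) → ℝ) : ℝ :=
  ∫ s in (0 : ℝ)..1, (1 - s) ^ N * ∫ v in cube p, (∏ r, v r ^ α r) * Φ s v

lemma continuous_monomial (α : Fin p → ℕ) : Continuous fun v : Fin p → ℝ => ∏ r, v r ^ α r :=
  continuous_finsetProd _ fun r _ => (continuous_apply r).pow _

lemma continuous_inner_integral (N : ℕ) (α : Fin p → ℕ) {Φ : ℝ → (Fin p → ℝ) → ℝ}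
    (hΦ : Continuous fun z : ℝ × (Fin p → ℝ) => Φ z.1 z.2) :
    Continuous fun s : ℝ => (1 - s) ^ N * ∫ v in cube p, (∏ r, v r ^ α r) * Φ s v := by
  refine ((continuous_const.sub continuous_id).pow N).mul
    (continuous_parametric_integral_of_continuous (f := fun s v => (∏ r, v r ^ α r) * Φ s v)
      ?_ isCompact_cube)
  exact ((continuous_monomial α).comp continuous_snd).mul hΦ

lemma integrableOn_cube {h : (Fin p → ℝ) → ℝ} (hh : Continuous h) : IntegrableOn h (cube p) :=
  hh.continuousOn.integrableOn_compact isCompact_cube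

lemma continuous_slice {Φ : ℝ → (Fin p → ℝ) → ℝ}
    (hΦ : Continuous fun z : ℝ × (Fin p → ℝ) => Φ z.1 z.2) (s : ℝ) : Continuous (Φ s) :=
  hΦ.comp (continuous_const.prodMk continuous_id)

lemma weightedIntegral_sum {ι : Type*} (N : ℕ) (α : Fin p → ℕ) (t : Finset ι) (w : ι → ℝ)
    {Φ : ι → ℝ → (Fin p → ℝ) → ℝ}
    (hΦ : ∀ i ∈ t, Continuous fun z : ℝ × (Fin p → ℝ) => Φ i z.1 z.2) :
    weightedIntegral N α (fun s v => ∑ i ∈ t, w i * Φ i s v) =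
      ∑ i ∈ t, w i * weightedIntegral N α (Φ i) := by
  have h1 : ∀ s, (1 - s) ^ N * ∫ v in cube p, (∏ r, v r ^ α r) * ∑ i ∈ t, w i * Φ i s v =
      ∑ i ∈ t, w i * ((1 - s) ^ N * ∫ v in cube p, (∏ r, v r ^ α r) * Φ i s v) := by
    intro s
    have h2 : ∫ v in cube p, (∏ r, v r ^ α r) * ∑ i ∈ t, w i * Φ i s v =
        ∑ i ∈ t, w i * ∫ v in cube p, (∏ r, v r ^ α r) * Φ i s v := by
      simp only [← integral_const_mul, Finset.mul_sum]
      rw [integral_finsetSum]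
      · refine Finset.sum_congr rfl fun i _ => ?_
        congr 1
        ext v
        ring
      · intro i hi
        exact integrableOn_cube ((continuous_monomial α).mul
          (continuous_const.mul (continuous_slice (hΦ i hi) s)))
    rw [h2, Finset.mul_sum]
    exact Finset.sum_congr rfl fun i _ => by ring
  simp only [weightedIntegral, h1]
  rw [intervalIntegral.integral_finsetSum]
  · simp only [intervalIntegral.integral_const_mul]
  · intro i hi
    exact (continuous_const.mul (continuous_inner_integral N α (hΦ i hi))).intervalIntegrable _ _

lemma weightedIntegral_swap (N : ℕ) (α : Fin p → ℕ) {Φ : ℝ → (Fin p → ℝ) → ℝ}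
    (hΦ : Continuous fun z : ℝ × (Fin p → ℝ) => Φ z.1 z.2) :
    ∫ v in cube p, (∏ r, v r ^ α r) * ∫ s in (0 : ℝ)..1, (1 - s) ^ N * Φ s v =
      weightedIntegral N α Φ := by
  simp only [weightedIntegral, ← integral_const_mul,
    intervalIntegral.integral_of_le (zero_le_one (α := ℝ)), ← integral_Icc_eq_integral_Ioc]
  rw [integral_integral_swap]
  · refine integral_congr_ae (Eventually.of_forall fun s => ?_)
    refine integral_congr_ae (Eventually.of_forall fun v => ?_)
    simp only
    ring
  · refine Continuous.integrable_prod_restrict ?_ isCompact_cube isCompact_Icc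
    exact ((continuous_monomial α).comp continuous_fst).mul
      (((continuous_const.sub continuous_snd).pow N).mul
        (hΦ.comp (continuous_snd.prodMk continuous_fst)))

lemma abs_monomial_le (α : Fin p → ℕ) {v : Fin p → ℝ} (hv : v ∈ cube p) :
    |∏ r, v r ^ α r| ≤ 1 := by
  rw [Finset.abs_prod]
  refine Finset.prod_le_one (fun r _ => abs_nonneg _) fun r _ => ?_
  rw [abs_pow]
  exact pow_le_one₀ (abs_nonneg _) (abs_le.2 ⟨hv.1 r, hv.2 r⟩)

/-- Dominated convergence in `v`, then in `s`. The bound is required only eventually, which is what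
uniform convergence of partial sums supplies. -/
lemma tendsto_weightedIntegral {ι : Type*} {l : Filter ι} [l.IsCountablyGenerated] (N : ℕ)
    (α : Fin p → ℕ) {Φ : ι → ℝ → (Fin p → ℝ) → ℝ} {Ψ : ℝ → (Fin p → ℝ) → ℝ} (C : ℝ)
    (hΦ : ∀ n, Continuous fun z : ℝ × (Fin p → ℝ) => Φ n z.1 z.2)
    (hC : ∀ᶠ n in l, ∀ s ∈ Set.Icc (0 : ℝ) 1, ∀ v ∈ cube p, |Φ n s v| ≤ C)
    (hlim : ∀ s ∈ Set.Icc (0 : ℝ) 1, ∀ v ∈ cube p,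
      Tendsto (fun n => Φ n s v) l (𝓝 (Ψ s v))) :
    Tendsto (fun n => weightedIntegral N α (Φ n)) l (𝓝 (weightedIntegral N α Ψ)) := by
  have hmc : MeasurableSet (cube p) := isCompact_cube.measurableSet
  have hb : ∀ {x y : ℝ}, |x| ≤ 1 → |y| ≤ C → ‖x * y‖ ≤ C := by
    intro x y hx hy
    rw [Real.norm_eq_abs, abs_mul]
    exact (mul_le_of_le_one_left (abs_nonneg y) hx).trans hy
  have hinner : ∀ n s, s ∈ Set.Icc (0 : ℝ) 1 →
      (∀ s ∈ Set.Icc (0 : ℝ) 1, ∀ v ∈ cube p, |Φ n s v| ≤ C) →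
      |∫ v in cube p, (∏ r, v r ^ α r) * Φ n s v| ≤ C * volume.real (cube p) := by
    intro n s hs h
    exact norm_setIntegral_le_of_norm_le_const isCompact_cube.measure_lt_top
      fun v hv => hb (abs_monomial_le α hv) (h s hs v hv)
  have hIoc : ∀ s ∈ Set.uIoc (0 : ℝ) 1, s ∈ Set.Icc (0 : ℝ) 1 := by
    intro s hs
    rw [Set.uIoc_of_le zero_le_one] at hs
    exact ⟨hs.1.le, hs.2⟩
  refine intervalIntegral.tendsto_integral_filter_of_dominated_convergence
    (fun _ => C * volume.real (cube p)) ?_ ?_ intervalIntegrable_const ?_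
  · exact Eventually.of_forall fun n => (continuous_inner_integral N α (hΦ n)).aestronglyMeasurable
  · filter_upwards [hC] with n hn
    refine Eventually.of_forall fun s hs => ?_
    have hs' := hIoc s hs
    rw [Real.norm_eq_abs, abs_mul]
    refine (mul_le_of_le_one_left (abs_nonneg _) ?_).trans (hinner n s hs' hn)
    rw [abs_pow]
    exact pow_le_one₀ (abs_nonneg _) (abs_le.2 ⟨by linarith [hs'.2], by linarith [hs'.1]⟩)
  · refine Eventually.of_forall fun s hs => Tendsto.const_mul _ ?_
    have hs' := hIoc s hs
    refine tendsto_integral_filter_of_dominated_convergence (fun _ => C) ?_ ?_ ?_ ?_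
    · exact Eventually.of_forall fun n =>
        ((continuous_monomial α).mul (continuous_slice (hΦ n) s)).aestronglyMeasurable
    · filter_upwards [hC] with n hn
      exact (ae_restrict_iff' hmc).2 (Eventually.of_forall fun v hv =>
        hb (abs_monomial_le α hv) (hn s hs' v hv))
    · exact integrableOn_const isCompact_cube.measure_lt_top.ne
    · exact (ae_restrict_iff' hmc).2 (Eventually.of_forall fun v hv =>
        (hlim s hs' v hv).const_mul _)

lemma continuous_shift_line {h : (Fin p → ℝ) → ℝ} (hh : Continuous h) (x : Fin p → ℝ)
    (j : Fin p → ℕ) :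
    Continuous fun z : ℝ × (Fin p → ℝ) => h (x + fun r => z.1 * (j r : ℝ) * z.2 r / 2) := by
  refine hh.comp (continuous_const.add (continuous_pi fun r => ?_))
  fun_prop

lemma continuous_mixedPartial_of_mem {m : ℕ} {g : (Fin p → ℝ) → ℝ}
    (hg : ContDiff ℝ ((2 * m : ℕ) : WithTop ℕ∞) g) {α : Fin p → ℕ}
    (hα : α ∈ Finset.piAntidiag (Finset.univ : Finset (Fin p)) (2 * m)) :
    Continuous (mixedPartial α g) := by
  have hα' := (Finset.mem_piAntidiag.1 hα).1
  exact (contDiff_mixedPartial (n := 0) α (by rwa [hα', zero_add])).continuous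

/-- The integral over a box of side lengths `j`, by Taylor's formula. -/
lemma integral_cube_taylor {m : ℕ} (hm : 1 ≤ m) {g : (Fin p → ℝ) → ℝ}
    (hg : ContDiff ℝ ((2 * m : ℕ) : WithTop ℕ∞) g) (x : Fin p → ℝ) (j : Fin p → ℕ) :
    ∫ v in cube p, g (x + fun r => (j r : ℝ) / 2 * v r) =
      ∑ q ∈ Finset.range (2 * m), ∑ α ∈ Finset.piAntidiag (Finset.univ : Finset (Fin p)) q,
        1 / (∏ i, ((α i).factorial : ℝ)) * mixedPartial α g x *
          ((∏ r, ((j r : ℝ) / 2) ^ α r) * ∫ v in cube p, ∏ r, v r ^ α r) +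
      2 * (m : ℝ) * ∑ α ∈ Finset.piAntidiag (Finset.univ : Finset (Fin p)) (2 * m),
        1 / (∏ i, ((α i).factorial : ℝ)) * ((∏ r, ((j r : ℝ) / 2) ^ α r) *
          weightedIntegral (2 * m - 1) α
            fun s v => mixedPartial α g (x + fun r => s * (j r : ℝ) * v r / 2)) := by
  have hs : ∀ (s : ℝ) (v : Fin p → ℝ), (s • fun r => (j r : ℝ) / 2 * v r) =
      fun r => s * (j r : ℝ) * v r / 2 := by
    intro s v
    ext r
    simp only [Pi.smul_apply, smul_eq_mul]
    ring
  have hcont : ∀ α ∈ Finset.piAntidiag (Finset.univ : Finset (Fin p)) (2 * m),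
      Continuous fun z : ℝ × (Fin p → ℝ) =>
        mixedPartial α g (x + fun r => z.1 * (j r : ℝ) * z.2 r / 2) := fun α hα =>
    continuous_shift_line (continuous_mixedPartial_of_mem hg hα) x j
  have h1 : ∀ v : Fin p → ℝ, g (x + fun r => (j r : ℝ) / 2 * v r) =
      ∑ q ∈ Finset.range (2 * m), ∑ α ∈ Finset.piAntidiag (Finset.univ : Finset (Fin p)) q,
        1 / (∏ i, ((α i).factorial : ℝ)) * mixedPartial α g x *
          ((∏ r, ((j r : ℝ) / 2) ^ α r) * ∏ r, v r ^ α r) +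
      2 * (m : ℝ) * ∑ α ∈ Finset.piAntidiag (Finset.univ : Finset (Fin p)) (2 * m),
        1 / (∏ i, ((α i).factorial : ℝ)) * ((∏ r, ((j r : ℝ) / 2) ^ α r) *
          ((∏ r, v r ^ α r) * ∫ s in (0 : ℝ)..1, (1 - s) ^ (2 * m - 1) *
            mixedPartial α g (x + fun r => s * (j r : ℝ) * v r / 2))) := by
    intro v
    rw [taylor_multivariate hm hg]
    congr 1
    · refine Finset.sum_congr rfl fun q _ => Finset.sum_congr rfl fun α _ => ?_
      simp only [zero_smul, add_zero, mul_pow, Finset.prod_mul_distrib]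
      ring
    · congr 1
      simp only [lineCoeff, hs, Finset.mul_sum, mul_pow, Finset.prod_mul_distrib]
      rw [intervalIntegral.integral_finsetSum]
      · refine Finset.sum_congr rfl fun α _ => ?_
        simp only [← intervalIntegral.integral_const_mul]
        congr 1
        ext s
        ring
      · intro α hα
        refine Continuous.intervalIntegrable ?_ _ _
        have := (hcont α hα).comp (continuous_id.prodMk (continuous_const (y := v)))
        exact ((continuous_const.sub continuous_id).pow _).mul
          (continuous_const.mul (continuous_const.mul this))
  have hpar : ∀ α ∈ Finset.piAntidiag (Finset.univ : Finset (Fin p)) (2 * m),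
      Continuous fun v : Fin p → ℝ => (∏ r, v r ^ α r) *
        ∫ s in (0 : ℝ)..1, (1 - s) ^ (2 * m - 1) *
            mixedPartial α g (x + fun r => s * (j r : ℝ) * v r / 2) := by
    intro α hα
    refine (continuous_monomial α).mul ?_
    refine intervalIntegral.continuous_parametric_intervalIntegral_of_continuous' ?_ _ _
    exact ((continuous_const.sub continuous_snd).pow _).mul
      ((hcont α hα).comp (continuous_snd.prodMk continuous_fst))
  simp only [h1]
  rw [integral_add, integral_const_mul, integral_finsetSum, integral_finsetSum]
  · congr 1
    · refine Finset.sum_congr rfl fun q _ => ?_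
      rw [integral_finsetSum]
      · simp only [integral_const_mul]
      · exact fun α _ => integrableOn_cube
          (continuous_const.mul (continuous_const.mul (continuous_monomial α)))
    · congr 1
      refine Finset.sum_congr rfl fun α hα => ?_
      rw [integral_const_mul, integral_const_mul, weightedIntegral_swap _ _ (hcont α hα)]
  · exact fun α hα => integrableOn_cube (continuous_const.mul (continuous_const.mul (hpar α hα)))
  · exact fun q _ => integrableOn_cube (continuous_finsetSum _ fun α _ =>
      continuous_const.mul (continuous_const.mul (continuous_monomial α)))
  · exact integrableOn_cube (continuous_finsetSum _ fun q _ => continuous_finsetSum _ fun α _ =>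
      continuous_const.mul (continuous_const.mul (continuous_monomial α)))
  · exact integrableOn_cube (continuous_const.mul (continuous_finsetSum _ fun α hα =>
      continuous_const.mul (continuous_const.mul (hpar α hα))))

/-- Taylor terms of order below `2m` add up to `g x` and cancel it, leaving only the integral
remainders of order `2m`. -/
lemma sum_gammaCoeff_integral_cube {m : ℕ} (hm : 1 ≤ m) {g : (Fin p → ℝ) → ℝ}
    (hg : ContDiff ℝ ((2 * m : ℕ) : WithTop ℕ∞) g) (x : Fin p → ℝ) :
    ∑ j ∈ indexBox p m, gammaCoeff m j *
      ((∏ r, (j r : ℝ) / 2) * ∫ v in cube p, g (x + fun r => (j r : ℝ) / 2 * v r)) - g x =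
    (m : ℝ) / 2 ^ (2 * m + p - 1) *
      ∑ α ∈ Finset.piAntidiag (Finset.univ : Finset (Fin p)) (2 * m),
        1 / (∏ r, ((α r).factorial : ℝ)) * ∑ j ∈ indexBox p m,
          gammaCoeff m j * (∏ r, (j r : ℝ) ^ (α r + 1)) * weightedIntegral (2 * m - 1) α
            fun s v => mixedPartial α g (x + fun r => s * (j r : ℝ) * v r / 2) := by
  simp only [integral_cube_taylor hm hg, mul_add, Finset.sum_add_distrib]
  have h1 : ∑ j ∈ indexBox p m, gammaCoeff m j * ((∏ r, (j r : ℝ) / 2) *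
      ∑ q ∈ Finset.range (2 * m), ∑ α ∈ Finset.piAntidiag (Finset.univ : Finset (Fin p)) q,
        1 / (∏ i, ((α i).factorial : ℝ)) * mixedPartial α g x *
          ((∏ r, ((j r : ℝ) / 2) ^ α r) * ∫ v in cube p, ∏ r, v r ^ α r)) = g x := by
    have h2 : ∀ q ∈ Finset.range (2 * m),
        ∀ α ∈ Finset.piAntidiag (Finset.univ : Finset (Fin p)) q,
        ∑ j ∈ indexBox p m, gammaCoeff m j * ((∏ r, (j r : ℝ) / 2) *
          (1 / (∏ i, ((α i).factorial : ℝ)) * mixedPartial α g x *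
          ((∏ r, ((j r : ℝ) / 2) ^ α r) * ∫ v in cube p, ∏ r, v r ^ α r))) =
        if α = 0 then g x else 0 := by
      intro q hq α hα
      have hα' : ∑ r, α r < 2 * m := by
        rw [(Finset.mem_piAntidiag.1 hα).1]
        exact Finset.mem_range.1 hq
      have h3 := sum_gammaCoeff_mul_integral hα'
      have h4 : ∀ j ∈ indexBox p m, gammaCoeff m j * ((∏ r, (j r : ℝ) / 2) *
          (1 / (∏ i, ((α i).factorial : ℝ)) * mixedPartial α g x *
          ((∏ r, ((j r : ℝ) / 2) ^ α r) * ∫ v in cube p, ∏ r, v r ^ α r))) =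
          1 / (∏ i, ((α i).factorial : ℝ)) * mixedPartial α g x *
          (gammaCoeff m j * ((∏ r, ((j r : ℝ) / 2) ^ (α r + 1)) *
            ∫ v in cube p, ∏ r, v r ^ α r)) := by
        intro j _
        simp only [pow_succ, Finset.prod_mul_distrib]
        ring
      rw [Finset.sum_congr rfl h4, ← Finset.mul_sum, h3]
      split_ifs with h0
      · subst h0; simp [mixedPartial_zero]
      · simp
    simp only [Finset.mul_sum]
    rw [Finset.sum_comm]
    have h5 : ∀ q ∈ Finset.range (2 * m), ∑ j ∈ indexBox p m,
        ∑ α ∈ Finset.piAntidiag (Finset.univ : Finset (Fin p)) q,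
        gammaCoeff m j * ((∏ r, (j r : ℝ) / 2) *
          (1 / (∏ i, ((α i).factorial : ℝ)) * mixedPartial α g x *
          ((∏ r, ((j r : ℝ) / 2) ^ α r) * ∫ v in cube p, ∏ r, v r ^ α r))) =
        if q = 0 then g x else 0 := by
      intro q hq
      rw [Finset.sum_comm, Finset.sum_congr rfl (h2 q hq), Finset.sum_ite_eq']
      simp [Finset.mem_piAntidiag, eq_comm]
    rw [Finset.sum_congr rfl h5, Finset.sum_ite_eq']
    simp; omega
  rw [h1, add_sub_cancel_left]
  simp only [Finset.mul_sum]
  rw [Finset.sum_comm]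
  refine Finset.sum_congr rfl fun α hα => Finset.sum_congr rfl fun j _ => ?_
  have hα' := (Finset.mem_piAntidiag.1 hα).1
  have h6 : (∏ r, (j r : ℝ) / 2) * ∏ r, ((j r : ℝ) / 2) ^ α r =
      (∏ r, (j r : ℝ) ^ (α r + 1)) / 2 ^ (2 * m + p) := by
    rw [← Finset.prod_mul_distrib]
    have : ∀ r ∈ Finset.univ, (j r : ℝ) / 2 * ((j r : ℝ) / 2) ^ α r =
        (j r : ℝ) ^ (α r + 1) / 2 ^ (α r + 1) := fun r _ => by rw [← pow_succ', div_pow]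
    rw [Finset.prod_congr rfl this, Finset.prod_div_distrib,
      Finset.prod_pow_eq_pow_sum Finset.univ (fun r => α r + 1) (2 : ℝ), Finset.sum_add_distrib]
    have hα'' : ∑ r, α r = 2 * m := hα'
    simp [hα'']
  -- One factor `2` cancels the `2` of `2m` in Taylor's remainder; the truncated exponent is
  -- harmless since `m ≥ 1`.
  have h7 : (2 : ℝ) ^ (2 * m + p) = 2 * 2 ^ (2 * m + p - 1) := by
    rw [← pow_succ']; congr 1; omega
  rw [h7] at h6
  calc _ = (gammaCoeff m j * (2 * (m : ℝ)) * (1 / (∏ i, ((α i).factorial : ℝ)))) *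
        ((∏ r, (j r : ℝ) / 2) * ∏ r, ((j r : ℝ) / 2) ^ α r) *
        weightedIntegral (2 * m - 1) α
          fun s v => mixedPartial α g (x + fun r => s * (j r : ℝ) * v r / 2) := by ring
    _ = _ := by
      rw [h6]
      field_simp

/-! ### The limit of the remainder -/

lemma HasIterPartial.shift {l : List (Fin p)} {G g : (Fin p → ℝ) → ℝ} (h : HasIterPartial l G g)
    (a : Fin p → ℝ) : HasIterPartial l (shift G a) (shift g a) := by
  induction l generalizing G with
  | nil =>
    obtain rfl : G = g := h
    rfl
  | cons r l ih =>
    obtain ⟨G', hd, hG'⟩ := h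
    refine ⟨AltSum.shift G' a, fun x => ?_, ih hG'⟩
    simpa only [act_trans_eq_shift] using HasDerivAt.act (trans a) hd x

lemma IsAntiderivative.shift {G g : (Fin p → ℝ) → ℝ} (h : IsAntiderivative G g)
    (a : Fin p → ℝ) : IsAntiderivative (shift G a) (shift g a) := by
  obtain ⟨l, hl, hG⟩ := h
  exact ⟨l, hl, hG.shift a⟩

lemma continuous_partialSum_shift {h : (Fin p → ℝ) → ℝ} (hh : Continuous h) (n : Fin p → ℕ) :
    Continuous fun u => partialSum (shift h u) n :=
  continuous_finsetSum _ fun _ _ => hh.comp (continuous_const.add continuous_id)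

lemma partialRemainder_eq {m : ℕ} (hm : 1 ≤ m) {G g : (Fin p → ℝ) → ℝ}
    (hg : ContDiff ℝ ((2 * m : ℕ) : WithTop ℕ∞) g) (hG : IsAntiderivative G g) (n : Fin p → ℕ) :
    partialRemainder m G g n = (m : ℝ) / 2 ^ (2 * m + p - 1) *
      ∑ α ∈ Finset.piAntidiag (Finset.univ : Finset (Fin p)) (2 * m),
        1 / (∏ r, ((α r).factorial : ℝ)) * weightedIntegral (2 * m - 1) α fun s v =>
          ∑ j ∈ indexBox p m, gammaCoeff m j * (∏ r, (j r : ℝ) ^ (α r + 1)) *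
            partialSum (shift (mixedPartial α g) (fun r => s * (j r : ℝ) * v r / 2)) n := by
  have h1 : ∀ x, ∑ j ∈ indexBox p m, gammaCoeff m j *
      act (∏ r, centralDiff r ((j r : ℝ) / 2)) G x - g x =
    (m : ℝ) / 2 ^ (2 * m + p - 1) *
      ∑ α ∈ Finset.piAntidiag (Finset.univ : Finset (Fin p)) (2 * m),
        1 / (∏ r, ((α r).factorial : ℝ)) * ∑ j ∈ indexBox p m,
          gammaCoeff m j * (∏ r, (j r : ℝ) ^ (α r + 1)) * weightedIntegral (2 * m - 1) α
            fun s v => mixedPartial α g (x + fun r => s * (j r : ℝ) * v r / 2) := by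
    intro x
    rw [← sum_gammaCoeff_integral_cube hm hg]
    congr 1
    exact Finset.sum_congr rfl fun j _ => by
      rw [act_prod_centralDiff (fun r => (j r : ℝ) / 2) hG hg.continuous]
  rw [partialRemainder_eq_sum]
  simp only [h1, partialSum]
  rw [← Finset.mul_sum, Finset.sum_comm]
  congr 1
  refine Finset.sum_congr rfl fun α hα => ?_
  have hc := continuous_mixedPartial_of_mem hg hα
  rw [← Finset.mul_sum, Finset.sum_comm, weightedIntegral_sum]
  · congr 1
    refine Finset.sum_congr rfl fun j _ => ?_
    rw [← Finset.mul_sum]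
    congr 1
    have := weightedIntegral_sum (2 * m - 1) α (Fintype.piFinset fun r => Finset.range (n r))
      (fun _ => 1) (Φ := fun k s v => mixedPartial α g
        ((fun r => (k r : ℝ)) + fun r => s * (j r : ℝ) * v r / 2))
      fun k _ => continuous_shift_line hc _ j
    simp only [one_mul] at this
    exact this.symm
  · intro j _
    exact continuous_finsetSum _ fun k _ => continuous_shift_line hc _ j

lemma UnifConv.tendsto_seriesSum {m : ℕ} {g : (Fin p → ℝ) → ℝ} (h : UnifConv m g) {α : Fin p → ℕ}
    (hα : ∑ r, α r = 2 * m) {u : Fin p → ℝ}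
    (hu : u ∈ Set.Icc (fun _ : Fin p => -((m : ℝ) / 2)) (fun _ => (m : ℝ) / 2)) :
    Tendsto (partialSum (shift (mixedPartial α g) u)) atTop
      (𝓝 (seriesSum (shift (mixedPartial α g) u))) := by
  obtain ⟨S, hS⟩ := h α hα
  exact tendsto_nhds_limUnder ⟨S u, hS.tendsto_at hu⟩

/-- One partial sum is continuous, hence bounded on the compact box; all later ones differ from it
by less than `2`. -/
lemma UnifConv.eventually_bounded {m : ℕ} {g : (Fin p → ℝ) → ℝ} (h : UnifConv m g)
    {α : Fin p → ℕ} (hα : ∑ r, α r = 2 * m) (hc : Continuous (mixedPartial α g)) :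
    ∃ C, ∀ᶠ n : Fin p → ℕ in atTop,
      ∀ u ∈ Set.Icc (fun _ : Fin p => -((m : ℝ) / 2)) (fun _ => (m : ℝ) / 2),
        |partialSum (shift (mixedPartial α g) u) n| ≤ C := by
  obtain ⟨S, hS⟩ := h α hα
  have h1 := Metric.tendstoUniformlyOn_iff.1 hS 1 one_pos
  obtain ⟨n₀, hn₀⟩ := h1.exists
  obtain ⟨M, hM⟩ := (isCompact_Icc (a := fun _ : Fin p => -((m : ℝ) / 2))
    (b := fun _ => (m : ℝ) / 2)).exists_bound_of_continuousOn
      (continuous_partialSum_shift hc n₀).continuousOn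
  refine ⟨M + 2, h1.mono fun n hn u hu => ?_⟩
  have e1 := hn u hu
  have e2 := hn₀ u hu
  have e3 := hM u hu
  rw [Real.dist_eq] at e1 e2
  rw [Real.norm_eq_abs] at e3
  rw [abs_lt] at e1 e2
  rw [abs_le] at e3 ⊢
  constructor <;> linarith [e1.1, e1.2, e2.1, e2.2, e3.1, e3.2]

/-- The evaluation points of the remainder stay in the box where (U) is assumed. -/
lemma line_mem_box {m : ℕ} {s : ℝ} (hs : s ∈ Set.Icc (0 : ℝ) 1) {v : Fin p → ℝ} (hv : v ∈ cube p)
    {j : Fin p → ℕ} (hj : j ∈ indexBox p m) :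
    (fun r => s * (j r : ℝ) * v r / 2) ∈
      Set.Icc (fun _ : Fin p => -((m : ℝ) / 2)) (fun _ => (m : ℝ) / 2) := by
  have key : ∀ r, |s * (j r : ℝ) * v r| ≤ m := by
    intro r
    have hj' : (j r : ℝ) ≤ m := by
      exact_mod_cast (Finset.mem_Icc.1 (Fintype.mem_piFinset.1 hj r)).2
    rw [mul_right_comm, abs_mul, abs_mul, Nat.abs_cast]
    have h1 : |s| * |v r| ≤ 1 := mul_le_one₀ (abs_le.2 ⟨by linarith [hs.1], hs.2⟩) (abs_nonneg _)
      (abs_le.2 ⟨hv.1 r, hv.2 r⟩)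
    exact (mul_le_of_le_one_left (Nat.cast_nonneg _) h1).trans hj'
  constructor <;> intro r <;> have := abs_le.1 (key r) <;> simp only <;>
    linarith [this.1, this.2]

lemma tendsto_partialRemainder {m : ℕ} (hm : 1 ≤ m) {G g : (Fin p → ℝ) → ℝ}
    (hg : ContDiff ℝ ((2 * m : ℕ) : WithTop ℕ∞) g) (hG : IsAntiderivative G g)
    (h : UnifConv m g) :
    Tendsto (partialRemainder m G g) atTop (𝓝 (remainder m g)) := by
  rw [funext (partialRemainder_eq hm hg hG)]
  refine Tendsto.const_mul _ (tendsto_finsetSum _ fun α hα => Tendsto.const_mul _ ?_)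
  have hα' : ∑ r, α r = 2 * m := (Finset.mem_piAntidiag.1 hα).1
  have hc := continuous_mixedPartial_of_mem hg hα
  obtain ⟨C, hC⟩ := h.eventually_bounded hα' hc
  refine tendsto_weightedIntegral (2 * m - 1) α
    (∑ j ∈ indexBox p m, |gammaCoeff m j * (∏ r, (j r : ℝ) ^ (α r + 1))| * C) ?_ ?_ ?_
  · intro n
    refine continuous_finsetSum _ fun j _ => continuous_const.mul ?_
    exact continuous_finsetSum _ fun k _ => continuous_shift_line hc _ j
  · filter_upwards [hC] with n hn s hs v hv
    refine (Finset.abs_sum_le_sum_abs _ _).trans (Finset.sum_le_sum fun j hj => ?_)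
    rw [abs_mul]
    exact mul_le_mul_of_nonneg_left (hn _ (line_mem_box hs hv hj)) (abs_nonneg _)
  · intro s hs v hv
    exact tendsto_finsetSum _ fun j hj =>
      (h.tendsto_seriesSum hα' (line_mem_box hs hv hj)).const_mul _

/-! ### The generalized sum and the decay of the remainder -/

lemma tendsto_subOn (c : Fin p → ℕ) (J : Finset (Fin p)) :
    Tendsto (fun n => subOn n c J) atTop atTop := by
  refine tendsto_atTop.2 fun b => (eventually_ge_atTop (b + c)).mono fun n hn r => ?_
  have h1 : b r + c r ≤ n r := hn r
  simp only [subOn]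
  split_ifs <;> omega

lemma contDiff_shift {n : WithTop ℕ∞} {f : (Fin p → ℝ) → ℝ} (hf : ContDiff ℝ n f)
    (a : Fin p → ℝ) : ContDiff ℝ n (shift f a) :=
  hf.comp (contDiff_id.add contDiff_const)

lemma hasAltSum_of_admissible {m m₀ : ℕ} (hp : 1 ≤ p) (hm₀ : 1 ≤ m₀) (hm : m₀ ≤ m)
    {f F : (Fin p → ℝ) → ℝ} (hf : ContDiff ℝ ((2 * m : ℕ) : WithTop ℕ∞) f)
    (hF : IsAntiderivative F f)
    (hF0 : ∀ α : Fin p → ℕ, ∑ r, α r = 2 * m₀ →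
      ∃ G : (Fin p → ℝ) → ℝ, HasMixedPartial α F G ∧ Tendsto G (atMaxTop p) (𝓝 0))
    (c : Fin p → ℕ)
    (hc : ∀ J : Finset (Fin p), J.Nonempty → UnifConv m (shift f (restrict c J))) :
    HasAltSum m₀ F f (partialSum f c - Atilde m F c - shiftedRemainder m f c) := by
  have h1 : Tendsto (fun n => partialSum f c - Atilde m F c +
      ∑ J : Finset (Fin p) with J.Nonempty, (-1) ^ J.card *
        partialRemainder m (shift F (restrict c J)) (shift f (restrict c J)) (subOn n c J) +
      (Atilde m F n - Atilde m₀ F n)) atTop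
      (𝓝 (partialSum f c - Atilde m F c - shiftedRemainder m f c)) := by
    have e : partialSum f c - Atilde m F c - shiftedRemainder m f c =
        partialSum f c - Atilde m F c + ∑ J : Finset (Fin p) with J.Nonempty,
          (-1) ^ J.card * remainder m (shift f (restrict c J)) + 0 := by
      rw [shiftedRemainder]; ring
    rw [e]
    refine Tendsto.add (tendsto_const_nhds.add (tendsto_finsetSum _ fun J hJ =>
      Tendsto.const_mul _ ?_)) (tendsto_Atilde_sub hp hm F hF0)
    exact (tendsto_partialRemainder (hm₀.trans hm) (contDiff_shift hf _) (hF.shift _)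
      (hc J (Finset.mem_filter.1 hJ).2)).comp (tendsto_subOn c J)
  refine h1.congr' ((eventually_ge_atTop c).mono fun n hn => ?_)
  rw [← partialSum_sub_Atilde m F f n c hn]
  ring

lemma tendsto_partialSum_sub_Atilde {m m₀ : ℕ} (hp : 1 ≤ p) (hm : m₀ ≤ m)
    {f F : (Fin p → ℝ) → ℝ}
    (hF0 : ∀ α : Fin p → ℕ, ∑ r, α r = 2 * m₀ →
      ∃ G : (Fin p → ℝ) → ℝ, HasMixedPartial α F G ∧ Tendsto G (atMaxTop p) (𝓝 0))
    {s : ℝ} (hs : HasAltSum m₀ F f s) :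
    Tendsto (fun c => partialSum f c - Atilde m F c) atTop (𝓝 s) := by
  have := Tendsto.sub hs (tendsto_Atilde_sub hp hm F hF0)
  rw [sub_zero] at this
  exact this.congr fun n => by ring

end AltSum

end

open AltSum
theorem theorem3p2 (p m m₀ : ℕ) (hp : 1 ≤ p) (hm₀ : 1 ≤ m₀) (hm : m₀ ≤ m)
    (f F : (Fin p → ℝ) → ℝ)
    (hf : ContDiff ℝ ((2 * m : ℕ) : WithTop ℕ∞) f)
    (hF : IsAntiderivative F f)
    (hF0 : ∀ α : Fin p → ℕ, ∑ r, α r = 2 * m₀ →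
      ∃ G : (Fin p → ℝ) → ℝ, HasMixedPartial α F G ∧
        Tendsto G (comap (fun x : Fin p → ℝ => ⨆ r, x r) atTop) (𝓝 0))
    (hconv : UnifConv m f) :
    (∀ c : Fin p → ℕ,
      (∀ J : Finset (Fin p), J.Nonempty → UnifConv m (shift f (restrict c J))) →
        HasAltSum m₀ F f (partialSum f c - Atilde m F c - shiftedRemainder m f c)) ∧
    (∀ ε : ℝ, 0 < ε → ∃ N : ℕ, ∀ c : Fin p → ℕ, (∀ r, N ≤ c r) →
      (∀ J : Finset (Fin p), J.Nonempty → UnifConv m (shift f (restrict c J))) →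
        |shiftedRemainder m f c| < ε) := by
  have hsum := fun c => hasAltSum_of_admissible hp hm₀ hm hf hF hF0 c
  refine ⟨hsum, fun ε hε => ?_⟩
  -- Condition (U) for `f` itself makes `c = 0` admissible, which provides the existence of the
  -- limit.
  have h0 : ∀ J : Finset (Fin p), J.Nonempty → UnifConv m (shift f (restrict 0 J)) := by
    intro J _
    have : shift f (restrict 0 J) = f := by
      ext x
      simp only [shift]
      congr 1
      ext r
      simp [restrict]
    rwa [this]
  have hlim := tendsto_partialSum_sub_Atilde hp hm hF0 (hsum 0 h0)
  obtain ⟨b, hb⟩ := eventually_atTop.1 ((Metric.tendsto_nhds.1 hlim) ε hε)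
  -- The sum of the coordinates of `b` dominates each of them, turning the threshold vector into a
  -- single `N`.
  refine ⟨∑ r, b r, fun c hc hadm => ?_⟩
  have hcb : b ≤ c := fun r =>
    (Finset.single_le_sum (f := b) (fun _ _ => Nat.zero_le _) (Finset.mem_univ r)).trans (hc r)
  have heq := tendsto_nhds_unique (hsum c hadm) (hsum 0 h0)
  have := hb c hcb
  rwa [Real.dist_eq, ← heq, sub_sub_cancel] at this
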